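/- Let $\mathbb T\subset\mathbb R$ be a time scale (a nonempty closed set) with $0,T\in\mathbb T$, $T>0$, and put $J=[0,T]_{\mathbb T}=[0,T]\cap\mathbb T$, with forward jump operator $\sigma$; write $u^\sigma=u\circ\sigma$ and let $\Delta t$ denote integration with respect to the Lebesgue $\Delta$-measure on $J^0=[0,T)_{\mathbb T}$. Let $H=H^1_{0,\Delta}(J)$ be the closure of $C^1_{0,rd}(J^\kappa)$ (continuous functions on $J$ vanishing at $0$ and $T$ with rd-continuous $\Delta$-derivative on $J^\kappa$) in the norm $(\|u\|_{L^2_\Delta}^2+\|u^\Delta\|_{L^2_\Delta}^2)^{1/2}$; elements of $H$ are identified with their continuous representatives on $J$. Let $\lambda_1$ be the smallest positive eigenvalue of $$-u^{\Delta\Delta}(t)=\mu\,u^\sigma(t),\quad t\in J^{\kappa^2},\qquad u(0)=0=u(T),$$ where $u^\Delta$ is regarded as a function on the time scale $J^\kappa$, and at $t=\max J^\kappa$, if that point is left-dense, $u^{\Delta\Delta}(t)$ is the left derivative of $u^\Delta$ and $u^\sigma(t)$ is read as $u(t)$. Let $\lambda\in\mathbb R$ satisfy $\lambda>-\lambda_1$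 (no condition if there is no such eigenvalue, i.e. if $J=\{0,T\}$). Let $p\ge 0$, let $0<t_1<\dots<t_p<T$ be right-dense points of $\mathbb T$, and let $f:J\times\mathbb R\to\mathbb R$ and $I_j:\mathbb R\to\mathbb R$ $(1\le j\le p)$ be continuous. With $F(t,x)=\int_0^x f(t,y)\,dy$, define $\varphi:H\to\mathbb R$ by $$\varphi(u)=\frac12\int_0^T (u^\Delta)^2\,\Delta t+\frac\lambda2\int_0^T (u^\sigma)^2\,\Delta t+\sum_{j=1}^p\int_0^{u(t_j)}I_j(x)\,dx-\int_0^T F(t,u^\sigma(t))\,\Delta t .$$ A weak solution of the impulsive Dirichlet problem $$(P)\quad -u^{\Delta\Delta}+\lambda u^\sigma=f(t,u^\sigma),\quad u^\Delta(t_j^+)-u^\Delta(t_j^-)=I_j(u(t_j^-))\ (1\le j\le p),\quad u(0)=0=u(T)$$ is a function $u\in H$ such that, for every $v\in H$, $$\int_0^T u^\Delta v^\Delta\,\Delta t+\lambda\int_0^T u^\sigma v^\sigma\,\Delta t=-\sum_{j=1}^p I_j(u(t_j^-))v(t_j)+\int_0^T f(t,u^\sigma(t))v^\sigma(t)\,\Delta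 t .$$ **Theorem.** Suppose that $f$ and the impulsive functions $I_1,\dots,I_p$ are bounded. Then $\varphi$ is coercive, i.e. $\varphi(u)\to+\infty$ as $\|u\|_H\to\infty$. Moreover there is $u\in H$ at which $\varphi$ attains its minimum over $H$; $\varphi$ is Fréchet differentiable at $u$ with $\varphi'(u)=0$, so $u$ is a critical point of $\varphi$, and $u$ is a weak solution of $(P)$. In particular $(P)$ has at least one weak solution. -/

import Mathlib

open Set Filter Topology MeasureTheory Asymptotics

noncomputable section

namespace TimeScale

/-! Time scales are closed subsets `S` of the real line. -/

/-- The forward jump operator `σ(t) = inf {s ∈ S : s > t}`, with `σ(max S) = max S`. -/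
def fwd (S : Set ℝ) (t : ℝ) : ℝ :=
  open Classical in if (S ∩ Ioi t).Nonempty then sInf (S ∩ Ioi t) else t

/-- The backward jump operator `ρ(t) = sup {s ∈ S : s < t}`, with `ρ(min S) = min S`. -/
def bwd (S : Set ℝ) (t : ℝ) : ℝ :=
  open Classical in if (S ∩ Iio t).Nonempty then sSup (S ∩ Iio t) else t

/-- `t ∈ S` is right-dense: `t < sup S` and `σ(t) = t`. -/
def IsRightDense (S : Set ℝ) (t : ℝ) : Prop := t ∈ S ∧ ¬ IsGreatest S t ∧ fwd S t = t

/-- `t ∈ S` is left-dense: `t > inf S` and `ρ(t) = t`. -/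
def IsLeftDense (S : Set ℝ) (t : ℝ) : Prop := t ∈ S ∧ ¬ IsLeast S t ∧ bwd S t = t

/-- `S^κ`: the set `S` without its maximum when that maximum exists and is left-scattered. -/
def kappa (S : Set ℝ) : Set ℝ := {t ∈ S | ¬ (IsGreatest S t ∧ bwd S t < t)}

/-- Hilger's delta derivative: `d` is the `Δ`-derivative of `f` at `t` if for each `ε > 0`,
`|f (σ t) - f s - d (σ t - s)| ≤ ε |σ t - s|` for all `s ∈ S` in a neighbourhood of `t`. -/
def HasDeltaDerivAt (S : Set ℝ) (f : ℝ → ℝ) (d t : ℝ) : Prop :=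
  (fun s => f (fwd S t) - f s - d * (fwd S t - s)) =o[𝓝[S] t] (fun s => fwd S t - s)

/-- `g` is rd-continuous on `S`: continuous at right-dense points, with finite left limits at
left-dense points. -/
def RdContinuousOn (S : Set ℝ) (g : ℝ → ℝ) : Prop :=
  (∀ t, IsRightDense S t → ContinuousWithinAt g S t) ∧
    ∀ t, IsLeftDense S t → ∃ l, Tendsto g (𝓝[S ∩ Iio t] t) (𝓝 l)

/-- The time scale interval `J = [0,T]_𝕋`. -/
def interval (𝕋 : Set ℝ) (T : ℝ) : Set ℝ := 𝕋 ∩ Icc 0 T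

/-- `φ ∈ C¹_{0,rd}(J^κ)`, with `Δ`-derivative `φ'`. -/
def IsC1ZeroRd (𝕋 : Set ℝ) (T : ℝ) (φ φ' : ℝ → ℝ) : Prop :=
  ContinuousOn φ (interval 𝕋 T) ∧
  (∀ t ∈ kappa (interval 𝕋 T), HasDeltaDerivAt (interval 𝕋 T) φ (φ' t) t) ∧
  RdContinuousOn (kappa (interval 𝕋 T)) φ' ∧ φ 0 = 0 ∧ φ T = 0

/-- The largest point of `J` not exceeding `x`. -/
def proj (𝕋 : Set ℝ) (T : ℝ) (x : ℝ) : ℝ := sSup (interval 𝕋 T ∩ Iic x)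

/-- The Lebesgue `Δ`-measure on `J⁰ = [0,T)_𝕋`, as a Borel measure on `ℝ` concentrated on `J⁰`:
the Borel measure with `μ([s,t)) = t - s` for `s ≤ t` in `J` (`deltaMeasure_Ico` and
`deltaMeasure_compl` below).  It is the image of Lebesgue measure on `[0,T)` under the map that
collapses each gap of `J` to its left end point, so that a right-scattered point `t` gets mass
`σ(t) - t`. -/
def deltaMeasure (𝕋 : Set ℝ) (T : ℝ) : Measure ℝ :=
  Measure.map (proj 𝕋 T) (volume.restrict (Ico 0 T))

/-- `L²_Δ(J⁰) × L²_Δ(J⁰)` with the Hilbert norm `(‖u‖² + ‖g‖²)^{1/2}`.  Its elements are seen as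
pairs `(u, u^Δ)`, so the norm is the one of `H¹_Δ(J)`. -/
abbrev L2Pair (𝕋 : Set ℝ) (T : ℝ) : Type :=
  WithLp 2 (Lp ℝ 2 (deltaMeasure 𝕋 T) × Lp ℝ 2 (deltaMeasure 𝕋 T))

theorem HasDeltaDerivAt.add {S : Set ℝ} {f g : ℝ → ℝ} {a b t : ℝ}
    (hf : HasDeltaDerivAt S f a t) (hg : HasDeltaDerivAt S g b t) :
    HasDeltaDerivAt S (f + g) (a + b) t := by
  unfold HasDeltaDerivAt at *
  refine (IsLittleO.add hf hg).congr_left fun s => ?_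
  simp only [Pi.add_apply]
  ring

theorem HasDeltaDerivAt.const_smul {S : Set ℝ} {f : ℝ → ℝ} {a t : ℝ} (c : ℝ)
    (hf : HasDeltaDerivAt S f a t) : HasDeltaDerivAt S (c • f) (c • a) t := by
  unfold HasDeltaDerivAt at *
  refine (IsLittleO.const_mul_left hf c).congr_left fun s => ?_
  simp only [Pi.smul_apply, smul_eq_mul]
  ring

theorem RdContinuousOn.add {S : Set ℝ} {f g : ℝ → ℝ} (hf : RdContinuousOn S f)
    (hg : RdContinuousOn S g) : RdContinuousOn S (f + g) := by
  refine ⟨fun t ht => (hf.1 t ht).add (hg.1 t ht), fun t ht => ?_⟩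
  obtain ⟨l, hl⟩ := hf.2 t ht
  obtain ⟨m, hm⟩ := hg.2 t ht
  exact ⟨l + m, hl.add hm⟩

theorem RdContinuousOn.const_smul {S : Set ℝ} {f : ℝ → ℝ} (c : ℝ) (hf : RdContinuousOn S f) :
    RdContinuousOn S (c • f) := by
  refine ⟨fun t ht => (hf.1 t ht).const_smul c, fun t ht => ?_⟩
  obtain ⟨l, hl⟩ := hf.2 t ht
  exact ⟨c • l, hl.const_smul c⟩

/-- The pairs `(φ, φ^Δ)` with `φ ∈ C¹_{0,rd}(J^κ)`. -/
def c1ZeroRd (𝕋 : Set ℝ) (T : ℝ) : Submodule ℝ (L2Pair 𝕋 T) where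
  carrier := {w | ∃ φ φ' : ℝ → ℝ, IsC1ZeroRd 𝕋 T φ φ' ∧
    w.fst =ᵐ[deltaMeasure 𝕋 T] φ ∧ w.snd =ᵐ[deltaMeasure 𝕋 T] φ'}
  add_mem' := by
    rintro v w ⟨φ, φ', ⟨h1, h2, h3, h4, h5⟩, h6, h7⟩ ⟨ψ, ψ', ⟨k1, k2, k3, k4, k5⟩, k6, k7⟩
    refine ⟨φ + ψ, φ' + ψ', ⟨h1.add k1, fun t ht => (h2 t ht).add (k2 t ht), h3.add k3, ?_, ?_⟩,
      ?_, ?_⟩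
    · simp [h4, k4]
    · simp [h5, k5]
    · exact (Lp.coeFn_add v.fst w.fst).trans (h6.add k6)
    · exact (Lp.coeFn_add v.snd w.snd).trans (h7.add k7)
  zero_mem' := by
    refine ⟨0, 0, ⟨continuousOn_const, fun t _ => ?_, ⟨fun t _ => continuousWithinAt_const,
      fun t _ => ⟨0, tendsto_const_nhds⟩⟩, rfl, rfl⟩, ?_, ?_⟩
    · simp [HasDeltaDerivAt]
    · exact Lp.coeFn_zero _ _ _
    · exact Lp.coeFn_zero _ _ _
  smul_mem' := by
    rintro c w ⟨φ, φ', ⟨h1, h2, h3, h4, h5⟩, h6, h7⟩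
    refine ⟨c • φ, c • φ', ⟨h1.const_smul c, fun t ht => (h2 t ht).const_smul c,
      h3.const_smul c, ?_, ?_⟩, ?_, ?_⟩
    · simp [h4]
    · simp [h5]
    · exact (Lp.coeFn_smul c w.fst).trans (h6.const_smul c)
    · exact (Lp.coeFn_smul c w.snd).trans (h7.const_smul c)

/-- `H¹_{0,Δ}(J)`: the closure of `C¹_{0,rd}(J^κ)` in the norm of `H¹_Δ(J)`, a Hilbert space.  An
element is the pair `(u, u^Δ)`. -/
def H10 (𝕋 : Set ℝ) (T : ℝ) : Submodule ℝ (L2Pair 𝕋 T) := (c1ZeroRd 𝕋 T).topologicalClosure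

/-- The `Δ`-derivative `u^Δ` of `u ∈ H¹_{0,Δ}(J)`. -/
def H10.delta {𝕋 : Set ℝ} {T : ℝ} (u : H10 𝕋 T) : ℝ → ℝ := (u : L2Pair 𝕋 T).snd

/-- The continuous representative of `u ∈ H¹_{0,Δ}(J)`, `u(t) = ∫_{[0,t)} u^Δ(s) Δs`; see
`H10.value_isRepresentative` below. -/
def H10.value {𝕋 : Set ℝ} {T : ℝ} (u : H10 𝕋 T) (t : ℝ) : ℝ :=
  ∫ s in Ico 0 t, H10.delta u s ∂(deltaMeasure 𝕋 T)

/-- `u^σ(t) = u(σ(t))`. -/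
def H10.shift {𝕋 : Set ℝ} {T : ℝ} (u : H10 𝕋 T) (t : ℝ) : ℝ :=
  H10.value u (fwd (interval 𝕋 T) t)

section facts

variable {𝕋 : Set ℝ} {T : ℝ}

theorem proj_spec (h : IsClosed 𝕋) (h0 : (0 : ℝ) ∈ 𝕋) (hT : 0 < T) {x : ℝ} (hx : 0 ≤ x) :
    proj 𝕋 T x ∈ interval 𝕋 T ∧ proj 𝕋 T x ≤ x ∧
      ∀ s ∈ interval 𝕋 T, s ≤ x → s ≤ proj 𝕋 T x := by
  have hne : (interval 𝕋 T ∩ Iic x).Nonempty := ⟨0, ⟨h0, le_rfl, hT.le⟩, hx⟩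
  have hbdd : BddAbove (interval 𝕋 T ∩ Iic x) := ⟨x, fun y hy => hy.2⟩
  have hcl : IsClosed (interval 𝕋 T ∩ Iic x) := (h.inter isClosed_Icc).inter isClosed_Iic
  have hmem := hcl.csSup_mem hne hbdd
  exact ⟨hmem.1, hmem.2, fun s hs hsx => le_csSup hbdd ⟨hs, hsx⟩⟩

theorem proj_monotoneOn (h : IsClosed 𝕋) (h0 : (0 : ℝ) ∈ 𝕋) (hT : 0 < T) :
    MonotoneOn (proj 𝕋 T) (Ico 0 T) := by
  intro x hx y hy hxy
  have h1 := proj_spec h h0 hT hx.1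
  exact (proj_spec h h0 hT hy.1).2.2 _ h1.1 (h1.2.1.trans hxy)

theorem proj_aemeasurable (h : IsClosed 𝕋) (h0 : (0 : ℝ) ∈ 𝕋) (hT : 0 < T) :
    AEMeasurable (proj 𝕋 T) (volume.restrict (Ico 0 T)) :=
  aemeasurable_restrict_of_monotoneOn measurableSet_Ico (proj_monotoneOn h h0 hT)

theorem proj_lt_iff (h : IsClosed 𝕋) (h0 : (0 : ℝ) ∈ 𝕋) (hT : 0 < T) {x t : ℝ} (hx : 0 ≤ x)
    (ht : t ∈ interval 𝕋 T) : proj 𝕋 T x < t ↔ x < t := by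
  obtain ⟨-, h2, h3⟩ := proj_spec h h0 hT hx
  exact ⟨fun hlt => not_le.1 fun hle => absurd (h3 t ht hle) (not_le.2 hlt), h2.trans_lt⟩

theorem proj_preimage_Ico (h : IsClosed 𝕋) (h0 : (0 : ℝ) ∈ 𝕋) (hT : 0 < T) {s t : ℝ}
    (hs : s ∈ interval 𝕋 T) (ht : t ∈ interval 𝕋 T) :
    proj 𝕋 T ⁻¹' Ico s t ∩ Ico 0 T = Ico s t := by
  ext x
  constructor
  · rintro ⟨⟨h1, h2⟩, h3, -⟩
    exact ⟨h1.trans (proj_spec h h0 hT h3).2.1, (proj_lt_iff h h0 hT h3 ht).1 h2⟩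
  · rintro ⟨h1, h2⟩
    have h3 : 0 ≤ x := hs.2.1.trans h1
    exact ⟨⟨not_lt.1 fun h4 => absurd ((proj_lt_iff h h0 hT h3 hs).1 h4) (not_lt.2 h1),
      (proj_lt_iff h h0 hT h3 ht).2 h2⟩, h3, h2.trans_le ht.2.2⟩

theorem deltaMeasure_Ico (h : IsClosed 𝕋) (h0 : (0 : ℝ) ∈ 𝕋) (hT : 0 < T) {s t : ℝ}
    (hs : s ∈ interval 𝕋 T) (ht : t ∈ interval 𝕋 T) :
    deltaMeasure 𝕋 T (Ico s t) = ENNReal.ofReal (t - s) := by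
  rw [deltaMeasure, Measure.map_apply_of_aemeasurable (proj_aemeasurable h h0 hT) measurableSet_Ico,
    Measure.restrict_apply' measurableSet_Ico, proj_preimage_Ico h h0 hT hs ht, Real.volume_Ico]

theorem deltaMeasure_compl (h : IsClosed 𝕋) (h0 : (0 : ℝ) ∈ 𝕋) (hT𝕋 : T ∈ 𝕋) (hT : 0 < T) :
    deltaMeasure 𝕋 T (interval 𝕋 T ∩ Ico 0 T)ᶜ = 0 := by
  have hm : MeasurableSet (interval 𝕋 T ∩ Ico 0 T) :=
    (h.measurableSet.inter measurableSet_Icc).inter measurableSet_Ico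
  rw [deltaMeasure, Measure.map_apply_of_aemeasurable (proj_aemeasurable h h0 hT) hm.compl,
    Measure.restrict_apply' measurableSet_Ico]
  convert measure_empty (μ := (volume : Measure ℝ))
  ext x
  simp only [mem_inter_iff, mem_preimage, mem_compl_iff, mem_empty_iff_false, iff_false]
  rintro ⟨h1, h2⟩
  have h3 := proj_spec h h0 hT h2.1
  exact h1 ⟨h3.1, h3.1.2.1, (proj_lt_iff h h0 hT h2.1 ⟨hT𝕋, hT.le, le_rfl⟩).2 h2.2⟩

instance : IsFiniteMeasure (deltaMeasure 𝕋 T) := by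
  unfold deltaMeasure
  infer_instance

/-- The piecewise linear interpolation of a function on `J`, given its derivative. -/
def interp (𝕋 : Set ℝ) (T : ℝ) (φ φ' : ℝ → ℝ) (x : ℝ) : ℝ :=
  φ (proj 𝕋 T x) + φ' (proj 𝕋 T x) * (x - proj 𝕋 T x)

theorem fwd_spec (h : IsClosed 𝕋) (hT𝕋 : T ∈ 𝕋) {r : ℝ} (hr : r ∈ interval 𝕋 T) (hrT : r < T) :
    fwd (interval 𝕋 T) r ∈ interval 𝕋 T ∧ r ≤ fwd (interval 𝕋 T) r ∧
      ∀ s ∈ interval 𝕋 T, r < s → fwd (interval 𝕋 T) r ≤ s := by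
  have hne : (interval 𝕋 T ∩ Ioi r).Nonempty := ⟨T, ⟨hT𝕋, hr.2.1.trans hrT.le, le_rfl⟩, hrT⟩
  have hbdd : BddBelow (interval 𝕋 T ∩ Ioi r) := ⟨r, fun y hy => hy.2.le⟩
  have hcl : IsClosed (interval 𝕋 T) := h.inter isClosed_Icc
  have hmem := csInf_mem_closure hne hbdd
  rw [fwd, if_pos hne]
  exact ⟨(closure_minimal inter_subset_left hcl) hmem, le_csInf hne fun y hy => hy.2.le,
    fun s hs hrs => csInf_le hbdd ⟨hs, hrs⟩⟩

theorem mem_kappa_of_lt (hT𝕋 : T ∈ 𝕋) (hT : 0 < T) {r : ℝ} (hr : r ∈ interval 𝕋 T) (hrT : r < T) :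
    r ∈ kappa (interval 𝕋 T) :=
  ⟨hr, fun hg => absurd (hg.1.2 ⟨hT𝕋, hT.le, le_rfl⟩) (not_le.2 hrT)⟩

theorem slope_of_scattered {S : Set ℝ} {φ : ℝ → ℝ} {d r : ℝ} (hr : r ∈ S)
    (hd : HasDeltaDerivAt S φ d r) : φ (fwd S r) = φ r + d * (fwd S r - r) := by
  have h1 : (fun s => φ (fwd S r) - φ s - d * (fwd S r - s)) =o[pure r] (fun s => fwd S r - s) :=
    hd.mono (pure_le_nhdsWithin hr)
  have h2 := isLittleO_pure.1 h1
  linarith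

theorem le_fwd_proj (h : IsClosed 𝕋) (h0 : (0 : ℝ) ∈ 𝕋) (hT𝕋 : T ∈ 𝕋) (hT : 0 < T) {y : ℝ}
    (hy : y ∈ Ico 0 T) : y ≤ fwd (interval 𝕋 T) (proj 𝕋 T y) := by
  obtain ⟨h1, h2, h3⟩ := proj_spec h h0 hT hy.1
  have hne : (interval 𝕋 T ∩ Ioi (proj 𝕋 T y)).Nonempty :=
    ⟨T, ⟨hT𝕋, hT.le, le_rfl⟩, h2.trans_lt hy.2⟩
  rw [fwd, if_pos hne]
  refine le_csInf hne fun s hs => ?_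
  by_contra hlt
  exact absurd (h3 s hs.1 (not_le.1 hlt).le) (not_le.2 hs.2)

theorem interp_bound (h : IsClosed 𝕋) (h0 : (0 : ℝ) ∈ 𝕋) (hT𝕋 : T ∈ 𝕋) (hT : 0 < T)
    {φ φ' : ℝ → ℝ} (hφ : IsC1ZeroRd 𝕋 T φ φ') {y A c p q : ℝ} (hy : y ∈ Ico 0 T)
    (hr : |φ (proj 𝕋 T y) - (A + c * proj 𝕋 T y)| ≤ p + q * proj 𝕋 T y)
    (hσ : |φ (fwd (interval 𝕋 T) (proj 𝕋 T y)) - (A + c * fwd (interval 𝕋 T) (proj 𝕋 T y))|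
      ≤ p + q * fwd (interval 𝕋 T) (proj 𝕋 T y)) :
    |interp 𝕋 T φ φ' y - (A + c * y)| ≤ p + q * y := by
  obtain ⟨h1, h2, h3⟩ := proj_spec h h0 hT hy.1
  have h4 := le_fwd_proj h h0 hT𝕋 hT hy
  have h5 := slope_of_scattered h1 (hφ.2.1 _ (mem_kappa_of_lt hT𝕋 hT h1 (h2.trans_lt hy.2)))
  rw [h5] at hσ
  unfold interp
  generalize proj 𝕋 T y = r at *
  generalize fwd (interval 𝕋 T) r = σ at *
  rcases h2.eq_or_lt with h6 | h6
  · subst h6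
    simpa using hr
  · rw [abs_le] at *
    have h7 : 0 < σ - r := by linarith
    constructor
    · refine le_of_mul_le_mul_left ?_ h7
      nlinarith [mul_le_mul_of_nonneg_left hr.1 (sub_nonneg.2 h4),
        mul_le_mul_of_nonneg_left hσ.1 (sub_nonneg.2 h2)]
    · refine le_of_mul_le_mul_left ?_ h7
      nlinarith [mul_le_mul_of_nonneg_left hr.2 (sub_nonneg.2 h4),
        mul_le_mul_of_nonneg_left hσ.2 (sub_nonneg.2 h2)]

theorem proj_eq_of_gap (h : IsClosed 𝕋) (h0 : (0 : ℝ) ∈ 𝕋) (hT : 0 < T) {r y : ℝ}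
    (hr : r ∈ interval 𝕋 T) (hry : r ≤ y) (hgap : ∀ s ∈ interval 𝕋 T, r < s → y < s) :
    proj 𝕋 T y = r := by
  obtain ⟨h1, h2, h3⟩ := proj_spec h h0 hT (hr.2.1.trans hry)
  rcases (h3 r hr hry).eq_or_lt with h4 | h4
  · exact h4.symm
  · exact absurd h2 (not_le.2 (hgap _ h1 h4))

theorem interp_hasDerivWithinAt (h : IsClosed 𝕋) (h0 : (0 : ℝ) ∈ 𝕋) (hT𝕋 : T ∈ 𝕋) (hT : 0 < T)
    {φ φ' : ℝ → ℝ} (hφ : IsC1ZeroRd 𝕋 T φ φ') {x : ℝ} (hx : x ∈ Ico 0 T) :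
    HasDerivWithinAt (interp 𝕋 T φ φ') (φ' (proj 𝕋 T x)) (Ioi x) x := by
  obtain ⟨h1, h2, h3⟩ := proj_spec h h0 hT hx.1
  have hsT : proj 𝕋 T x < T := h2.trans_lt hx.2
  obtain ⟨k1, k2, k3⟩ := fwd_spec h hT𝕋 h1 hsT
  rcases (le_fwd_proj h h0 hT𝕋 hT hx).lt_or_eq with hlt | heq
  · have hd : HasDerivWithinAt (fun y => φ (proj 𝕋 T x) + φ' (proj 𝕋 T x) * (y - proj 𝕋 T x))
        (φ' (proj 𝕋 T x)) (Ioi x) x := by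
      have := (((hasDerivAt_id x).sub_const (proj 𝕋 T x)).const_mul
        (φ' (proj 𝕋 T x))).const_add (φ (proj 𝕋 T x))
      simpa using this.hasDerivWithinAt
    refine hd.congr_of_eventuallyEq ?_ rfl
    filter_upwards [Ioo_mem_nhdsGT hlt] with y hy
    rw [interp, proj_eq_of_gap h h0 hT h1 (h2.trans hy.1.le)
      fun s hs hrs => hy.2.trans_le (k3 s hs hrs)]
  · have hxJ : x ∈ interval 𝕋 T := heq ▸ k1
    have hpx : proj 𝕋 T x = x := le_antisymm h2 (h3 x hxJ le_rfl)
    rw [hpx] at heq k1 k2 k3 ⊢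
    have hd := hφ.2.1 x (mem_kappa_of_lt hT𝕋 hT hxJ hx.2)
    unfold HasDeltaDerivAt at hd
    rw [← heq] at hd
    rw [hasDerivWithinAt_iff_isLittleO, isLittleO_iff]
    intro ε hε
    have he := isLittleO_iff.1 hd hε
    rw [eventually_nhdsWithin_iff, Metric.eventually_nhds_iff] at he
    obtain ⟨δ, hδ, he⟩ := he
    have hne : (interval 𝕋 T ∩ Ioi x).Nonempty := ⟨T, ⟨hT𝕋, hT.le, le_rfl⟩, hx.2⟩
    have hinf : sInf (interval 𝕋 T ∩ Ioi x) < x + δ := by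
      rw [fwd, if_pos hne] at heq
      linarith
    obtain ⟨s, hs, hsδ⟩ := exists_lt_of_csInf_lt hne hinf
    have key : ∀ z ∈ interval 𝕋 T, x ≤ z → z ≤ s →
        |φ z - (φ x - φ' x * x + φ' x * z)| ≤ -(ε * x) + ε * z := by
      intro z hz hxz hzs
      have := he (y := z) (by rw [Real.dist_eq, abs_lt]; constructor <;> linarith) hz
      rw [Real.norm_eq_abs, Real.norm_eq_abs, abs_sub_comm x z, abs_of_nonneg (sub_nonneg.2 hxz),
        abs_sub_comm, ← abs_neg] at this
      convert this using 1
      · rw [← abs_neg]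
        congr 1
        ring
      · ring
    filter_upwards [Ioo_mem_nhdsGT (show x < s from hs.2)] with y hy
    have hyT : y ∈ Ico 0 T := ⟨hx.1.trans hy.1.le, hy.2.trans_le hs.1.2.2⟩
    obtain ⟨l1, l2, l3⟩ := proj_spec h h0 hT hyT.1
    obtain ⟨m1, m2, m3⟩ := fwd_spec h hT𝕋 l1 (l2.trans_lt hyT.2)
    have hxr := l3 x hxJ hy.1.le
    have := interp_bound h h0 hT𝕋 hT hφ hyT (key _ l1 hxr (l2.trans hy.2.le))
      (key _ m1 (hxr.trans m2) (m3 s hs.1 (l2.trans_lt hy.2)))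
    have hix : interp 𝕋 T φ φ' x = φ x := by simp [interp, hpx]
    rw [hix, Real.norm_eq_abs, Real.norm_eq_abs, abs_of_pos (sub_pos.2 hy.1), smul_eq_mul]
    convert this using 1
    · congr 1
      ring
    · ring

theorem interp_left_continuous (h : IsClosed 𝕋) (h0 : (0 : ℝ) ∈ 𝕋) (hT𝕋 : T ∈ 𝕋) (hT : 0 < T)
    {φ φ' : ℝ → ℝ} (hφ : IsC1ZeroRd 𝕋 T φ φ') {x : ℝ} (hx : x ∈ Ioc 0 T) :
    ContinuousWithinAt (interp 𝕋 T φ φ') (Iic x) x := by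
  obtain ⟨h1, h2, h3⟩ := proj_spec h h0 hT hx.1.le
  by_cases hgap : ∃ r ∈ interval 𝕋 T, r < x ∧ ∀ s ∈ interval 𝕋 T, r < s → x ≤ s
  · obtain ⟨r, hr, hrx, hg⟩ := hgap
    have hxv : interp 𝕋 T φ φ' x = φ r + φ' r * (x - r) := by
      by_cases hxJ : x ∈ interval 𝕋 T
      · have hpx : proj 𝕋 T x = x := le_antisymm h2 (h3 x hxJ le_rfl)
        have hrT : r < T := hrx.trans_le hx.2
        obtain ⟨k1, k2, k3⟩ := fwd_spec h hT𝕋 hr hrT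
        have hf : fwd (interval 𝕋 T) r = x := by
          refine le_antisymm (k3 x hxJ hrx) ?_
          have hne : (interval 𝕋 T ∩ Ioi r).Nonempty := ⟨x, hxJ, hrx⟩
          rw [fwd, if_pos hne]
          exact le_csInf hne fun s hs => hg s hs.1 hs.2
        have := slope_of_scattered hr (hφ.2.1 _ (mem_kappa_of_lt hT𝕋 hT hr hrT))
        rw [hf] at this
        simp [interp, hpx, this]
      · rw [interp, proj_eq_of_gap h h0 hT hr hrx.le fun s hs hrs =>
          lt_of_le_of_ne (hg s hs hrs) fun he => hxJ (he ▸ hs)]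
    have hc : ContinuousWithinAt (fun y => φ r + φ' r * (y - r)) (Iic x) x := by
      apply Continuous.continuousWithinAt
      fun_prop
    refine hc.congr_of_eventuallyEq ?_ hxv
    filter_upwards [Ioc_mem_nhdsLE hrx] with y hy
    rcases hy.2.eq_or_lt with he | hlt
    · rw [he, hxv]
    · rw [interp, proj_eq_of_gap h h0 hT hr hy.1.le fun s hs hrs => hlt.trans_le (hg s hs hrs)]
  · push Not at hgap
    have hpx : proj 𝕋 T x = x := by
      refine h2.eq_or_lt.resolve_right fun hlt => ?_
      obtain ⟨s, hs, hs1, hs2⟩ := hgap _ h1 hlt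
      exact absurd (h3 s hs hs2.le) (not_le.2 hs1)
    have hxJ : x ∈ interval 𝕋 T := hpx ▸ h1
    have hix : interp 𝕋 T φ φ' x = φ x := by simp [interp, hpx]
    have hne : (interval 𝕋 T ∩ Iio x).Nonempty := ⟨0, ⟨h0, le_rfl, hT.le⟩, hx.1⟩
    have hbdd : BddAbove (interval 𝕋 T ∩ Iio x) := ⟨x, fun y hy => hy.2.le⟩
    have hsup : x ≤ sSup (interval 𝕋 T ∩ Iio x) := by
      by_contra hlt
      rw [not_le] at hlt
      have hmem : sSup (interval 𝕋 T ∩ Iio x) ∈ interval 𝕋 T :=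
        closure_minimal inter_subset_left (h.inter isClosed_Icc) (csSup_mem_closure hne hbdd)
      obtain ⟨s, hs, hs1, hs2⟩ := hgap _ hmem hlt
      exact absurd (le_csSup hbdd ⟨hs, hs2⟩) (not_le.2 hs1)
    rw [ContinuousWithinAt, hix, Metric.tendsto_nhds]
    intro ε hε
    have hc : ∀ᶠ z in 𝓝[interval 𝕋 T] x, dist (φ z) (φ x) < ε / 2 :=
      Metric.tendsto_nhds.1 (hφ.1 x hxJ) (ε / 2) (by linarith)
    rw [eventually_nhdsWithin_iff, Metric.eventually_nhds_iff] at hc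
    obtain ⟨δ, hδ, hc⟩ := hc
    obtain ⟨s, hs, hsδ⟩ := exists_lt_of_lt_csSup hne (show x - δ < _ by linarith)
    have key : ∀ z ∈ interval 𝕋 T, s ≤ z → z ≤ x → |φ z - (φ x + 0 * z)| ≤ ε / 2 + 0 * z := by
      intro z hz hsz hzx
      have := hc (y := z) (by rw [Real.dist_eq, abs_lt]; constructor <;> linarith) hz
      rw [Real.dist_eq] at this
      simpa using this.le
    filter_upwards [Ioc_mem_nhdsLE (show s < x from hs.2)] with y hy
    rcases hy.2.eq_or_lt with he | hlt
    · rw [he, hix, dist_self]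
      exact hε
    · have hyT : y ∈ Ico 0 T := ⟨hs.1.2.1.trans hy.1.le, hlt.trans_le hx.2⟩
      obtain ⟨l1, l2, l3⟩ := proj_spec h h0 hT hyT.1
      obtain ⟨m1, m2, m3⟩ := fwd_spec h hT𝕋 l1 (l2.trans_lt hyT.2)
      have hsr := l3 s hs.1 hy.1.le
      have := interp_bound h h0 hT𝕋 hT hφ hyT (key _ l1 hsr (l2.trans hy.2))
        (key _ m1 (hsr.trans m2) (m3 x hxJ (l2.trans_lt hlt)))
      rw [Real.dist_eq]
      simp only [zero_mul, add_zero] at this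
      linarith

theorem interp_continuousOn (h : IsClosed 𝕋) (h0 : (0 : ℝ) ∈ 𝕋) (hT𝕋 : T ∈ 𝕋) (hT : 0 < T)
    {φ φ' : ℝ → ℝ} (hφ : IsC1ZeroRd 𝕋 T φ φ') :
    ContinuousOn (interp 𝕋 T φ φ') (Icc 0 T) := by
  intro x hx
  have hl : ContinuousWithinAt (interp 𝕋 T φ φ') (Icc 0 x) x := by
    rcases hx.1.eq_or_lt with he | hlt
    · rw [← he, Icc_self]
      exact continuousWithinAt_singleton
    · exact (interp_left_continuous h h0 hT𝕋 hT hφ ⟨hlt, hx.2⟩).mono Icc_subset_Iic_self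
  have hr : ContinuousWithinAt (interp 𝕋 T φ φ') (Icc x T) x := by
    rcases hx.2.eq_or_lt with he | hlt
    · rw [he, Icc_self]
      exact continuousWithinAt_singleton
    · have := (interp_hasDerivWithinAt h h0 hT𝕋 hT hφ ⟨hx.1, hlt⟩).continuousWithinAt
      exact (continuousWithinAt_Ioi_iff_Ici.1 this).mono Icc_subset_Ici_self
  rw [← Icc_union_Icc_eq_Icc hx.1 hx.2]
  exact hl.union hr

theorem setIntegral_deltaMeasure (h : IsClosed 𝕋) (h0 : (0 : ℝ) ∈ 𝕋) (hT : 0 < T)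
    {g : ℝ → ℝ} (hg : AEStronglyMeasurable g (deltaMeasure 𝕋 T)) {t : ℝ} (ht : t ∈ interval 𝕋 T) :
    ∫ s in Ico 0 t, g s ∂(deltaMeasure 𝕋 T) = ∫ x in (0)..t, g (proj 𝕋 T x) := by
  have hm := proj_aemeasurable h h0 hT
  rw [intervalIntegral.integral_of_le ht.2.1, integral_Ioc_eq_integral_Ioo,
    ← integral_Ico_eq_integral_Ioo]
  have h1 := Measure.restrict_map_of_aemeasurable hm (measurableSet_Ico (a := (0 : ℝ)) (b := t))
  have h2 : (volume.restrict (Ico 0 T)).restrict (proj 𝕋 T ⁻¹' Ico 0 t)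
      = volume.restrict (Ico 0 t) := by
    rw [Measure.restrict_restrict' measurableSet_Ico,
      proj_preimage_Ico h h0 hT ⟨h0, le_rfl, hT.le⟩ ht]
  rw [h2] at h1
  have h3 : AEStronglyMeasurable g
      (Measure.map (proj 𝕋 T) (volume.restrict (Ico 0 t))) := by
    rw [← h1]
    exact hg.restrict
  rw [deltaMeasure, h1, integral_map _ h3]
  exact hm.mono_measure (Measure.restrict_mono (Ico_subset_Ico_right ht.2.2) le_rfl)

/-- The fundamental theorem of calculus for `φ ∈ C¹_{0,rd}(J^κ)`. -/
theorem setIntegral_delta (h : IsClosed 𝕋) (h0 : (0 : ℝ) ∈ 𝕋) (hT𝕋 : T ∈ 𝕋) (hT : 0 < T)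
    {φ φ' : ℝ → ℝ} (hφ : IsC1ZeroRd 𝕋 T φ φ') (hi : Integrable φ' (deltaMeasure 𝕋 T)) {t : ℝ}
    (ht : t ∈ interval 𝕋 T) : ∫ s in Ico 0 t, φ' s ∂(deltaMeasure 𝕋 T) = φ t := by
  have hm := proj_aemeasurable h h0 hT
  have hint : IntegrableOn (fun x => φ' (proj 𝕋 T x)) (Ico 0 T) := by
    exact hi.comp_aemeasurable hm
  rw [setIntegral_deltaMeasure h h0 hT hi.1 ht,
    intervalIntegral.integral_eq_sub_of_hasDeriv_right_of_le ht.2.1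
      ((interp_continuousOn h h0 hT𝕋 hT hφ).mono (Icc_subset_Icc_right ht.2.2))
      (fun x hx => interp_hasDerivWithinAt h h0 hT𝕋 hT hφ ⟨hx.1.le, hx.2.trans_le ht.2.2⟩)]
  · have h1 : proj 𝕋 T 0 = 0 := by
      obtain ⟨k1, k2, k3⟩ := proj_spec h h0 hT le_rfl
      exact le_antisymm k2 k1.2.1
    have h2 : proj 𝕋 T t = t := by
      obtain ⟨k1, k2, k3⟩ := proj_spec h h0 hT ht.2.1
      exact le_antisymm k2 (k3 t ht le_rfl)
    simp [interp, h1, h2, hφ.2.2.2.1]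
  · rw [intervalIntegrable_iff_integrableOn_Ico_of_le ht.2.1]
    exact hint.mono_set (Ico_subset_Ico_right ht.2.2)

/-- `H10.value u` is the continuous representative of `u ∈ H¹_{0,Δ}(J)`. -/
theorem H10.value_isRepresentative (h : IsClosed 𝕋) (h0 : (0 : ℝ) ∈ 𝕋) (hT𝕋 : T ∈ 𝕋) (hT : 0 < T)
    (u : H10 𝕋 T) :
    ContinuousOn (H10.value u) (interval 𝕋 T) ∧ H10.value u 0 = 0 ∧ H10.value u T = 0 ∧
      (u : L2Pair 𝕋 T).fst =ᵐ[deltaMeasure 𝕋 T] H10.value u := by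
  have hm := proj_aemeasurable h h0 hT
  have hTJ : T ∈ interval 𝕋 T := ⟨hT𝕋, hT.le, le_rfl⟩
  have hint : ∀ g : Lp ℝ 2 (deltaMeasure 𝕋 T), Integrable g (deltaMeasure 𝕋 T) := fun g =>
    (Lp.memLp g).integrable (by norm_num)
  have hJ : ∀ᵐ t ∂(deltaMeasure 𝕋 T), t ∈ interval 𝕋 T := by
    have hsub : {t | ¬ t ∈ interval 𝕋 T} ⊆ (interval 𝕋 T ∩ Ico 0 T)ᶜ := fun t ht hm => ht hm.1
    exact measure_mono_null hsub (deltaMeasure_compl h h0 hT𝕋 hT)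
  obtain ⟨w, hw, hlim⟩ := mem_closure_iff_seq_limit.1 (show (u : L2Pair 𝕋 T) ∈ closure _ from u.2)
  have hlim1 : Tendsto (fun n => (w n).fst) atTop (𝓝 (u : L2Pair 𝕋 T).fst) :=
    ((WithLp.prod_continuous_ofLp 2 _ _).fst.tendsto _).comp hlim
  have hlim2 : Tendsto (fun n => (w n).snd) atTop (𝓝 (u : L2Pair 𝕋 T).snd) :=
    ((WithLp.prod_continuous_ofLp 2 _ _).snd.tendsto _).comp hlim
  have hval : ∀ t, Tendsto (fun n => ∫ s in Ico 0 t, (w n).snd s ∂(deltaMeasure 𝕋 T)) atTop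
      (𝓝 (H10.value u t)) := by
    intro t
    have hfin : deltaMeasure 𝕋 T (Ico 0 t) ≠ ⊤ := measure_ne_top _ _
    have := (tendsto_const_nhds (x := indicatorConstLp 2 measurableSet_Ico hfin (1 : ℝ))).inner
      (𝕜 := ℝ) hlim2
    simp only [L2.inner_indicatorConstLp_one] at this
    exact this
  choose φ φ' hφ hφ1 hφ2 using hw
  have hftc : ∀ n, ∀ t ∈ interval 𝕋 T,
      ∫ s in Ico 0 t, (w n).snd s ∂(deltaMeasure 𝕋 T) = φ n t := by
    intro n t ht
    rw [← setIntegral_delta h h0 hT𝕋 hT (hφ n) ((hint _).congr (hφ2 n)) ht]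
    exact integral_congr_ae (ae_restrict_of_ae (hφ2 n))
  refine ⟨?_, by simp [H10.value], ?_, ?_⟩
  · have hI : IntegrableOn (fun x => H10.delta u (proj 𝕋 T x)) (uIcc 0 T) := by
      rw [uIcc_of_le hT.le, integrableOn_Icc_iff_integrableOn_Ico]
      exact (hint (u : L2Pair 𝕋 T).snd).comp_aemeasurable hm
    have hc := intervalIntegral.continuousOn_primitive_interval hI
    rw [uIcc_of_le hT.le] at hc
    exact (hc.mono inter_subset_right).congr fun t ht =>
      setIntegral_deltaMeasure h h0 hT (hint (u : L2Pair 𝕋 T).snd).1 ht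
  · refine tendsto_nhds_unique (hval T) ?_
    simp only [fun n => hftc n T hTJ, fun n => (hφ n).2.2.2.2]
    exact tendsto_const_nhds
  · obtain ⟨ns, hmono, hns⟩ := (tendstoInMeasure_of_tendsto_Lp hlim1).exists_seq_tendsto_ae
    have hall : ∀ᵐ t ∂(deltaMeasure 𝕋 T), ∀ n, (w n).fst t = φ n t := ae_all_iff.2 hφ1
    filter_upwards [hns, hall, hJ] with t ht1 ht2 ht3
    refine tendsto_nhds_unique ht1 ?_
    refine ((hval t).comp hmono.tendsto_atTop).congr fun n => ?_
    simp only [Function.comp_apply, hftc (ns n) t ht3, ht2]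

end facts

/-- `μ` is an eigenvalue of `-u^{ΔΔ}(t) = μ u^σ(t)`, `t ∈ J^{κ²}`, `u(0) = 0 = u(T)`.
Here `u' = u^Δ` is a function on the time scale `J^κ`, and `u^{ΔΔ}` is its `Δ`-derivative there; the
jump operator `σ` of the equation is accordingly that of `J^κ`.  It agrees with that of `J` on
`J^{κ²}`, except when `T` is left-scattered and `t = ρ(T)` is left-dense: then `t` is the maximum of
`J^κ` and `u^{ΔΔ}(t)` is a left derivative. -/
def IsDirichletEigenvalue (𝕋 : Set ℝ) (T μ : ℝ) : Prop :=
  ∃ u u' : ℝ → ℝ, (∃ t ∈ interval 𝕋 T, u t ≠ 0) ∧ u 0 = 0 ∧ u T = 0 ∧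
    (∀ t ∈ kappa (interval 𝕋 T), HasDeltaDerivAt (interval 𝕋 T) u (u' t) t) ∧
    (∀ t ∈ kappa (kappa (interval 𝕋 T)),
      HasDeltaDerivAt (kappa (interval 𝕋 T)) u' (-(μ * u (fwd (kappa (interval 𝕋 T)) t))) t)

/-- The energy functional
`φ(u) = ½∫(u^Δ)² + (λ/2)∫(u^σ)² + ∑ⱼ ∫₀^{u(tⱼ)} Iⱼ - ∫ F(t, u^σ(t)) Δt` with
`F(t,x) = ∫₀^x f(t,y) dy`. -/
def energy (𝕋 : Set ℝ) (T lam : ℝ) {p : ℕ} (f : ℝ → ℝ → ℝ) (τ : Fin p → ℝ) (I : Fin p → ℝ → ℝ)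
    (u : H10 𝕋 T) : ℝ :=
  (1 / 2) * (∫ t, (H10.delta u t) ^ 2 ∂(deltaMeasure 𝕋 T))
    + (lam / 2) * (∫ t, (H10.shift u t) ^ 2 ∂(deltaMeasure 𝕋 T))
    + (∑ j, (∫ x in (0)..(H10.value u (τ j)), I j x))
    - (∫ t, (∫ x in (0)..(H10.shift u t), f t x) ∂(deltaMeasure 𝕋 T))

/-- `u` is a weak solution of the impulsive Dirichlet problem.  As `u` is continuous on `J`,
`u(tⱼ⁻) = u(tⱼ)`. -/
def IsWeakSolution (𝕋 : Set ℝ) (T lam : ℝ) {p : ℕ} (f : ℝ → ℝ → ℝ) (τ : Fin p → ℝ)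
    (I : Fin p → ℝ → ℝ) (u : H10 𝕋 T) : Prop :=
  ∀ v : H10 𝕋 T,
    (∫ t, H10.delta u t * H10.delta v t ∂(deltaMeasure 𝕋 T))
      + lam * (∫ t, H10.shift u t * H10.shift v t ∂(deltaMeasure 𝕋 T))
    = -(∑ j, I j (H10.value u (τ j)) * H10.value v (τ j))
      + (∫ t, f t (H10.shift u t) * H10.shift v t ∂(deltaMeasure 𝕋 T))

end TimeScale

end

/-! The proof is the direct method. Write `D u` for u^Δ in L²_Δ and `ι` for the embedding of H into
C(J). By the Poincaré inequality `H10.exists_norm_le`, ‖D u‖ controls ‖u‖. Since u(t) is the inner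
product of u^Δ with the indicator of [0,t), a continuous curve in L²_Δ, Arzelà–Ascoli makes `ι`
compact. The energy has the form ½‖D u‖² + Ψ(ι u) with Ψ differentiable on C(J).

Coercivity: bounded f and I_j contribute at most a multiple of ‖D u‖, so it suffices that the
quadratic part dominates a‖D u‖² with a > 0. Let k be the best constant in ∫(u^σ)² ≤ k∫(u^Δ)². By
compactness it is attained, and a maximizer solves the weak eigenvalue problem for k⁻¹
(`exists_rayleigh_maximizer`). A du Bois-Reymond argument makes it a classical eigenfunction
(`isDirichletEigenvalue_of_weak`); conversely every classical eigenvalue is at least k⁻¹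
(`le_of_isDirichletEigenvalue`). Hence λ₁ = k⁻¹, and λ > -λ₁ says 1 + λk > 0.

Existence: `exists_minimizer_of_compact` gives a minimizer. The derivative vanishes there, and its
value at v is the difference of the two sides of the weak equation. -/

namespace TimeScale

/-! ### Abstract variational principles with a compact operator -/

section Variational

variable {H L L' E : Type*} [NormedAddCommGroup H] [InnerProductSpace ℝ H]
  [NormedAddCommGroup L] [InnerProductSpace ℝ L] [NormedAddCommGroup L'] [InnerProductSpace ℝ L']
  [NormedAddCommGroup E] [NormedSpace ℝ E]

/-- Serves both the energy and the auxiliary functional behind the Rayleigh quotient: `hD` forces ‖D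
u‖ → ∞, and there the quadratic term wins. -/
theorem tendsto_atTop_of_quadratic_le (D : H →L[ℝ] L) {C : ℝ} (hD : ∀ u, ‖u‖ ≤ C * ‖D u‖)
    {φ : H → ℝ} {a b : ℝ} (ha : 0 < a) (hφ : ∀ u, a * ‖D u‖ ^ 2 - b * ‖D u‖ ≤ φ u) :
    Tendsto φ (Bornology.cobounded H) atTop := by
  have h1 : Tendsto (fun u => ‖D u‖) (Bornology.cobounded H) atTop := by
    have hC : 0 < |C| + 1 := by positivity
    have h2 : Tendsto (fun u : H => ‖u‖ / (|C| + 1)) (Bornology.cobounded H) atTop :=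
      tendsto_norm_cobounded_atTop.atTop_div_const hC
    refine tendsto_atTop_mono (fun u => ?_) h2
    rw [div_le_iff₀ hC]
    have h3 : C * ‖D u‖ ≤ |C| * ‖D u‖ := by gcongr; exact le_abs_self C
    linarith [hD u, norm_nonneg (D u)]
  have h2 : Tendsto (fun x : ℝ => x * (a * x + -b)) atTop atTop :=
    tendsto_id.atTop_mul_atTop₀
      (tendsto_atTop_add_const_right _ _ (tendsto_id.const_mul_atTop ha))
  refine tendsto_atTop_mono (fun u => ?_) (h2.comp h1)
  simp only [Function.comp_apply]
  linarith [hφ u]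

/-- A coercive functional `½‖D u‖² + Ψ(ι u)` with `ι` compact and `Ψ` continuous has a minimizer:
by the parallelogram law a minimizing sequence along which `ι` converges is a Cauchy sequence. -/
theorem exists_minimizer_of_compact [CompleteSpace H] (D : H →L[ℝ] L) (ι : H →L[ℝ] E) {C : ℝ}
    (hD : ∀ u, ‖u‖ ≤ C * ‖D u‖) (hι : IsCompactOperator ι) {Ψ : E → ℝ} (hΨ : Continuous Ψ)
    (hco : Tendsto (fun u => (1 / 2) * ‖D u‖ ^ 2 + Ψ (ι u)) (Bornology.cobounded H) atTop) :
    ∃ u, ∀ v, (1 / 2) * ‖D u‖ ^ 2 + Ψ (ι u) ≤ (1 / 2) * ‖D v‖ ^ 2 + Ψ (ι v) := by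
  set φ : H → ℝ := fun u => (1 / 2) * ‖D u‖ ^ 2 + Ψ (ι u) with hφdef
  have hφc : Continuous φ := by fun_prop
  have hsub : ∀ M, ∃ R, ∀ u, φ u < M → ‖u‖ ≤ R := by
    intro M
    have h1 : {u | M ≤ φ u} ∈ Bornology.cobounded H := hco (Ici_mem_atTop M)
    have h2 : Bornology.IsBounded {u | M ≤ φ u}ᶜ := Bornology.isBounded_def.2 (by simpa using h1)
    obtain ⟨R, hR⟩ := h2.exists_norm_le
    exact ⟨R, fun u hu => hR u (by simpa using hu)⟩
  have hbdd : BddBelow (range φ) := by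
    -- The level 0 is arbitrary: below it u stays in a ball, whose image under `ι` lies in a compact
    -- set where Ψ is bounded below.
    obtain ⟨R, hR⟩ := hsub 0
    obtain ⟨K, hK, hKi⟩ := hι.image_closedBall_subset_compact R
    obtain ⟨b, hb⟩ := (hK.image hΨ).bddBelow
    refine ⟨min 0 b, ?_⟩
    rintro _ ⟨u, rfl⟩
    rcases lt_or_ge (φ u) 0 with hu | hu
    · have h1 : b ≤ Ψ (ι u) :=
        hb ⟨ι u, hKi ⟨u, mem_closedBall_zero_iff.2 (hR u hu), rfl⟩, rfl⟩
      have h2 : 0 ≤ (1 / 2) * ‖D u‖ ^ 2 := by positivity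
      exact (min_le_right _ _).trans (by simp only [hφdef]; linarith)
    · exact (min_le_left _ _).trans hu
  have hinf : ∀ u, sInf (range φ) ≤ φ u := fun u => csInf_le hbdd ⟨u, rfl⟩
  set a := sInf (range φ) with ha
  have hseq : ∀ n : ℕ, ∃ u, φ u < a + 1 / ((n : ℝ) + 1) := fun n => by
    obtain ⟨_, ⟨u, rfl⟩, hu⟩ := exists_lt_of_csInf_lt (range_nonempty φ)
      (show sInf (range φ) < a + 1 / ((n : ℝ) + 1) by
        rw [← ha]; have : 0 < 1 / ((n : ℝ) + 1) := by positivity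
        linarith)
    exact ⟨u, hu⟩
  choose w hw using hseq
  obtain ⟨R, hR⟩ := hsub (a + 1)
  have hwR : ∀ n, ‖w n‖ ≤ R := fun n => by
    refine hR _ ((hw n).trans_le ?_)
    have : 1 / ((n : ℝ) + 1) ≤ 1 := by
      rw [div_le_one (by positivity)]; linarith [(Nat.cast_nonneg n : (0 : ℝ) ≤ n)]
    linarith
  obtain ⟨K, hK, hKi⟩ := hι.image_closedBall_subset_compact R
  obtain ⟨e, -, ns, hns, hlim⟩ := hK.tendsto_subseq
    (x := fun n => ι (w n)) fun n => hKi ⟨w n, mem_closedBall_zero_iff.2 (hwR n), rfl⟩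
  have hφlim : Tendsto (fun n => φ (w n)) atTop (𝓝 a) := by
    refine tendsto_of_tendsto_of_tendsto_of_le_of_le tendsto_const_nhds ?_ (fun n => hinf (w n))
      (fun n => (hw n).le)
    simpa using tendsto_one_div_add_atTop_nhds_zero_nat.const_add a
  set z : ℕ → H := fun n => w (ns n) with hz
  have hφz : Tendsto (fun n => φ (z n)) atTop (𝓝 a) := hφlim.comp hns.tendsto_atTop
  have hιz : Tendsto (fun n => ι (z n)) atTop (𝓝 e) := hlim
  have hcauchy : CauchySeq z := by
    rw [cauchySeq_iff_tendsto_dist_atTop_0]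
    -- In the parallelogram law for D z₁ and D z₂, replace each ½‖D z‖² by φ(z) - Ψ(ι z), and bound
    -- φ at the midpoint below by the infimum a. As Ψ(ι z₁), Ψ(ι z₂) and the midpoint value of Ψ
    -- have the same limit, X → 0.
    set X : ℕ × ℕ → ℝ := fun q => 8 * ((1 / 2) * φ (z q.1) + (1 / 2) * φ (z q.2) - a
      - ((1 / 2) * Ψ (ι (z q.1)) + (1 / 2) * Ψ (ι (z q.2))
        - Ψ ((1 / 2 : ℝ) • (ι (z q.1) + ι (z q.2))))) with hX
    have hle : ∀ q : ℕ × ℕ, ‖D (z q.1 - z q.2)‖ ^ 2 ≤ X q := by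
      intro q
      have h1 := hinf ((1 / 2 : ℝ) • (z q.1 + z q.2))
      have h2 := parallelogram_law_with_norm ℝ (D (z q.1)) (D (z q.2))
      simp only [hX, hφdef, map_smul, map_add, map_sub, norm_smul, mul_pow] at h1 ⊢
      norm_num at h1 ⊢
      nlinarith
    have hX0 : Tendsto X atTop (𝓝 0) := by
      rw [← prod_atTop_atTop_eq]
      have a1 := hφz.comp (tendsto_fst (f := atTop (α := ℕ)) (g := atTop (α := ℕ)))
      have a2 := hφz.comp (tendsto_snd (f := atTop (α := ℕ)) (g := atTop (α := ℕ)))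
      have b1 := hιz.comp (tendsto_fst (f := atTop (α := ℕ)) (g := atTop (α := ℕ)))
      have b2 := hιz.comp (tendsto_snd (f := atTop (α := ℕ)) (g := atTop (α := ℕ)))
      have c1 := (hΨ.tendsto e).comp b1
      have c2 := (hΨ.tendsto e).comp b2
      have c3 := (hΨ.tendsto _).comp ((b1.add b2).const_smul (1 / 2 : ℝ))
      have := ((((a1.const_mul (1 / 2)).add (a2.const_mul (1 / 2))).sub_const a).sub
        (((c1.const_mul (1 / 2)).add (c2.const_mul (1 / 2))).sub c3)).const_mul 8
      have he : (1 / 2 : ℝ) • (e + e) = e := by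
        rw [← two_smul ℝ e, smul_smul]; norm_num
      rw [he, show 8 * (1 / 2 * a + 1 / 2 * a - a - (1 / 2 * Ψ e + 1 / 2 * Ψ e - Ψ e)) = 0 by ring]
        at this
      exact this
    have hsq : Tendsto (fun q => |C| * √(X q)) atTop (𝓝 0) := by
      have := (hX0.sqrt).const_mul |C|
      simpa using this
    refine squeeze_zero (fun _ => dist_nonneg) (fun q => ?_) hsq
    rw [dist_eq_norm]
    calc ‖z q.1 - z q.2‖ ≤ C * ‖D (z q.1 - z q.2)‖ := hD _
      _ ≤ |C| * ‖D (z q.1 - z q.2)‖ := by gcongr; exact le_abs_self C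
      _ ≤ |C| * √(X q) := by
        gcongr
        exact Real.le_sqrt_of_sq_le (hle q)
  obtain ⟨u, hu⟩ := cauchySeq_tendsto_of_complete hcauchy
  refine ⟨u, fun v => ?_⟩
  have : φ u = a := tendsto_nhds_unique ((hφc.tendsto u).comp hu) hφz
  change φ u ≤ φ v
  rw [this]
  exact hinf v

/-- The best constant `k` in `‖S w‖² ≤ k ‖D w‖²` is attained when `S` is compact, and a maximizer
solves the corresponding weak eigenvalue problem. -/
theorem exists_rayleigh_maximizer [CompleteSpace H] (D : H →L[ℝ] L) (ι : H →L[ℝ] E) (S : E →L[ℝ] L')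
    {C : ℝ} (hD : ∀ u, ‖u‖ ≤ C * ‖D u‖) (hι : IsCompactOperator ι) (hne : ∃ w, S (ι w) ≠ 0) :
    ∃ k > 0, ∃ u, S (ι u) ≠ 0 ∧ (∀ w, ‖S (ι w)‖ ^ 2 ≤ k * ‖D w‖ ^ 2) ∧
      ∀ v, k * inner ℝ (D u) (D v) = inner ℝ (S (ι u)) (S (ι v)) := by
  -- Subtracting ‖S(ι u)‖ rather than its square keeps the functional coercive; the sharp constant
  -- is recovered by scaling.
  have hco : Tendsto (fun u => (1 / 2) * ‖D u‖ ^ 2 + -‖S (ι u)‖) (Bornology.cobounded H) atTop := by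
    refine tendsto_atTop_of_quadratic_le D hD (a := 1 / 2) (b := ‖S.comp ι‖ * C) (by norm_num)
      fun u => ?_
    have h1 : ‖S (ι u)‖ ≤ ‖S.comp ι‖ * ‖u‖ := (S.comp ι).le_opNorm u
    have h2 : ‖S.comp ι‖ * ‖u‖ ≤ ‖S.comp ι‖ * (C * ‖D u‖) := by gcongr; exact hD u
    linarith
  obtain ⟨u, hu⟩ := exists_minimizer_of_compact D ι hD hι
    (Ψ := fun e => -‖S e‖) (by fun_prop) hco
  -- The minimum equals -k/2. Comparing it with the value at r • w gives a quadratic in r that is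
  -- nonnegative, and its discriminant is the bound ‖S(ι w)‖² ≤ k‖D w‖².
  set k := 2 * (‖S (ι u)‖ - (1 / 2) * ‖D u‖ ^ 2) with hk
  have hray : ∀ w, ∀ r : ℝ, 0 ≤ r → 0 ≤ ‖D w‖ ^ 2 * (r * r) - 2 * ‖S (ι w)‖ * r + k := by
    intro w r hr
    have h1 := hu (r • w)
    simp only [map_smul, norm_smul, Real.norm_eq_abs, abs_of_nonneg hr] at h1
    nlinarith
  have hk0 : 0 ≤ k := by simpa using hray 0 0 le_rfl
  have hbound : ∀ w, ‖S (ι w)‖ ^ 2 ≤ k * ‖D w‖ ^ 2 := by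
    intro w
    have h1 : ∀ r : ℝ, 0 ≤ ‖D w‖ ^ 2 * (r * r) + (-(2 * ‖S (ι w)‖)) * r + k := by
      intro r
      rcases le_total 0 r with hr | hr
      · linarith [hray w r hr]
      · have := norm_nonneg (S (ι w))
        nlinarith [mul_nonneg (sq_nonneg ‖D w‖) (mul_self_nonneg r), mul_nonneg this (neg_nonneg.2 hr)]
    have := discrim_le_zero h1
    unfold discrim at this
    linarith
  obtain ⟨w, hw⟩ := hne
  have hkpos : 0 < k := by
    refine hk0.lt_of_ne fun h0 => ?_
    have h1 := hbound w
    rw [← h0, zero_mul] at h1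
    have : 0 < ‖S (ι w)‖ ^ 2 := by positivity
    linarith
  have hSk : ‖S (ι u)‖ ^ 2 = k * ‖D u‖ ^ 2 := by
    have h1 := hbound u
    -- By the choice of k, ‖S(ι u)‖ is the arithmetic mean of k and ‖D u‖², so its square is at
    -- least their product.
    have h2 : ‖S (ι u)‖ = (k + ‖D u‖ ^ 2) / 2 := by rw [hk]; ring
    refine le_antisymm h1 ?_
    rw [h2]
    nlinarith [sq_nonneg (k - ‖D u‖ ^ 2)]
  refine ⟨k, hkpos, u, fun h0 => ?_, hbound, fun v => ?_⟩
  · rw [h0] at hk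
    simp only [norm_zero] at hk
    nlinarith [sq_nonneg ‖D u‖]
  -- The form k‖D ·‖² - ‖S(ι ·)‖² is nonnegative and vanishes at u, so along u + r • v its linear
  -- coefficient in r must vanish; the discriminant expresses this.
  · have h1 : ∀ r : ℝ, 0 ≤ (k * ‖D v‖ ^ 2 - ‖S (ι v)‖ ^ 2) * (r * r)
        + (2 * (k * inner ℝ (D u) (D v) - inner ℝ (S (ι u)) (S (ι v)))) * r + 0 := by
      intro r
      have h2 := hbound (u + r • v)
      simp only [map_add, map_smul, norm_add_sq_real, inner_smul_right, norm_smul, mul_pow,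
        Real.norm_eq_abs, sq_abs] at h2
      nlinarith
    have h2 := discrim_le_zero h1
    unfold discrim at h2
    have h3 : k * inner ℝ (D u) (D v) - inner ℝ (S (ι u)) (S (ι v)) = 0 := by
      refine pow_eq_zero_iff (two_ne_zero) |>.1 (le_antisymm ?_ (sq_nonneg _))
      linarith
    linarith

/-- The operator `w ↦ (x ↦ ⟪κ x, w⟫)` into `C(K, ℝ)`. -/
noncomputable def innerKernel {K : Type*} [TopologicalSpace K] [CompactSpace K] (κ : C(K, L)) :
    L →L[ℝ] C(K, ℝ) :=
  LinearMap.mkContinuous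
    { toFun := fun w => ⟨fun x => inner ℝ (κ x) w, by fun_prop⟩
      map_add' := fun v w => by ext x; simp [inner_add_right]
      map_smul' := fun c w => by ext x; simp [inner_smul_right] } ‖κ‖ fun w => by
    refine (ContinuousMap.norm_le _ (by positivity)).2 fun x => ?_
    exact (norm_inner_le_norm (κ x) w).trans (by gcongr; exact κ.norm_coe_le_norm x)

/-- Arzelà–Ascoli: on the unit ball the images are bounded by ‖κ‖ and share the modulus of
continuity of κ. -/
theorem isCompactOperator_innerKernel {K : Type*} [TopologicalSpace K] [CompactSpace K]
    (κ : C(K, L)) : IsCompactOperator (innerKernel κ) := by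
  rw [isCompactOperator_iff_exists_mem_nhds_isCompact_closure_image]
  refine ⟨Metric.closedBall 0 1, Metric.closedBall_mem_nhds 0 one_pos, ?_⟩
  set A : Set (BoundedContinuousFunction K ℝ) :=
    (ContinuousMap.equivBoundedOfCompact K ℝ) '' (innerKernel κ '' Metric.closedBall 0 1) with hA
  have hA1 : IsCompact (closure A) := by
    refine BoundedContinuousFunction.arzela_ascoli (Metric.closedBall 0 ‖κ‖)
      (isCompact_closedBall _ _) A ?_ ?_
    · rintro _ x ⟨_, ⟨w, hw, rfl⟩, rfl⟩
      rw [mem_closedBall_zero_iff] at hw ⊢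
      change ‖inner ℝ (κ x) w‖ ≤ ‖κ‖
      refine (norm_inner_le_norm (κ x) w).trans ?_
      have := κ.norm_coe_le_norm x
      nlinarith [norm_nonneg (κ x), norm_nonneg w]
    · intro x
      rw [Metric.equicontinuousAt_iff_right]
      intro ε hε
      filter_upwards [Metric.tendsto_nhds.1 (κ.continuous.tendsto x) ε hε] with y hy
      rintro ⟨_, _, ⟨w, hw, rfl⟩, rfl⟩
      rw [mem_closedBall_zero_iff] at hw
      change dist (inner ℝ (κ x) w) (inner ℝ (κ y) w) < ε
      rw [dist_comm, dist_eq_norm, ← inner_sub_left]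
      refine (norm_inner_le_norm (κ y - κ x) w).trans_lt ?_
      rw [dist_eq_norm] at hy
      nlinarith [norm_nonneg (κ y - κ x)]
  have h2 : innerKernel κ '' Metric.closedBall 0 1 =
      (ContinuousMap.isometryEquivBoundedOfCompact K ℝ).symm.toHomeomorph '' A := by
    rw [hA, image_image (ContinuousMap.isometryEquivBoundedOfCompact K ℝ).symm.toHomeomorph]
    convert (image_id _).symm
    exact (ContinuousMap.isometryEquivBoundedOfCompact K ℝ).symm_apply_apply _
  rw [h2, ← Homeomorph.image_closure]
  exact hA1.image (Homeomorph.continuous _)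

end Variational

end TimeScale

namespace TimeScale

/-! ### Integral functionals on C(K) -/

section Nemytskii

variable {K : Type*} [TopologicalSpace K] [CompactSpace K] [MeasurableSpace K] [BorelSpace K]
  {μ : Measure ℝ} {A : Set ℝ} {s : ℝ → K} {f : ℝ → ℝ → ℝ}

theorem integrable_of_continuous_comp [IsFiniteMeasure μ] (hA : IsCompact A)
    (hμA : ∀ᵐ t ∂μ, t ∈ A) (hs : Measurable s) (hf : Continuous (Function.uncurry f))
    (e : C(K, ℝ)) : Integrable (fun t => f t (e (s t))) μ := by
  obtain ⟨M, hM⟩ := (hA.prod (isCompact_closedBall (0 : ℝ) ‖e‖)).exists_bound_of_continuousOn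
    hf.continuousOn
  refine Integrable.of_bound (C := M) ?_ ?_
  · exact (hf.measurable.comp
      (measurable_id.prodMk (e.continuous.measurable.comp hs))).aestronglyMeasurable
  · filter_upwards [hμA] with t ht
    exact hM (t, e (s t)) ⟨ht, mem_closedBall_zero_iff.2 (e.norm_coe_le_norm _)⟩

theorem continuous_primitive (hf : Continuous (Function.uncurry f)) :
    Continuous (Function.uncurry fun t x => ∫ y in (0)..x, f t y) := by
  have h1 : Continuous (Function.uncurry fun (q : ℝ × ℝ) (y : ℝ) => f q.1 y) :=
    hf.comp (by fun_prop : Continuous fun r : (ℝ × ℝ) × ℝ => (r.1.1, r.2))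
  exact intervalIntegral.continuous_parametric_intervalIntegral_of_continuous h1 continuous_snd

/-- The remainder is the integral of g y - g a from a to a + b. The bound depends only on δ and ε,
so uniform continuity of f makes it uniform in t. -/
theorem norm_primitive_sub_le {g : ℝ → ℝ} (hg : Continuous g) {a b ε δ : ℝ} (hb : |b| < δ)
    (h : ∀ y, |y - a| < δ → |g y - g a| ≤ ε) :
    ‖(∫ y in (0)..(a + b), g y) - (∫ y in (0)..a, g y) - g a * b‖ ≤ ε * |b| := by
  have h1 : (∫ y in (0)..(a + b), g y) - (∫ y in (0)..a, g y) - g a * b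
      = ∫ y in a..(a + b), (g y - g a) := by
    rw [intervalIntegral.integral_sub (hg.intervalIntegrable _ _) (by simp),
      intervalIntegral.integral_interval_sub_left (hg.intervalIntegrable _ _)
        (hg.intervalIntegrable _ _), intervalIntegral.integral_const, smul_eq_mul]
    ring
  rw [h1]
  have h2 := intervalIntegral.norm_integral_le_of_norm_le_const (a := a) (b := a + b) (C := ε)
    (f := fun y => g y - g a) fun y hy => ?_
  · simpa using h2
  · refine h y (lt_of_le_of_lt ?_ hb)
    have := abs_sub_left_of_mem_uIcc (uIoc_subset_uIcc hy)
    simpa using this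

/-- Differentiability of the integral functional `e ↦ ∫ F(t, e(s t)) dμ`, `F` a primitive of `f`. -/
theorem exists_hasFDerivAt_integral_primitive [IsFiniteMeasure μ] (hA : IsCompact A)
    (hμA : ∀ᵐ t ∂μ, t ∈ A) (hs : Measurable s) (hf : Continuous (Function.uncurry f))
    (e : C(K, ℝ)) :
    ∃ Λ : C(K, ℝ) →L[ℝ] ℝ,
      HasFDerivAt (fun e : C(K, ℝ) => ∫ t, (∫ x in (0)..(e (s t)), f t x) ∂μ) Λ e ∧
        ∀ h, Λ h = ∫ t, f t (e (s t)) * h (s t) ∂μ := by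
  obtain ⟨M, hM⟩ := (hA.prod (isCompact_closedBall (0 : ℝ) ‖e‖)).exists_bound_of_continuousOn
    hf.continuousOn
  have hsm : ∀ h : C(K, ℝ), Measurable fun t => h (s t) := fun h => h.continuous.measurable.comp hs
  have hfi := integrable_of_continuous_comp hA hμA hs hf e
  have hint : ∀ h : C(K, ℝ), Integrable (fun t => f t (e (s t)) * h (s t)) μ := fun h =>
    hfi.mul_bdd (c := ‖h‖) (hsm h).aestronglyMeasurable
      (Eventually.of_forall fun t => h.norm_coe_le_norm _)
  let Λ : C(K, ℝ) →L[ℝ] ℝ := LinearMap.mkContinuous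
    { toFun := fun h => ∫ t, f t (e (s t)) * h (s t) ∂μ
      map_add' := fun h k => by
        rw [← integral_add (hint h) (hint k)]
        simp [mul_add]
      map_smul' := fun c h => by
        rw [RingHom.id_apply, smul_eq_mul, ← integral_const_mul]
        congr 1
        ext t
        simp
        ring } (M * μ.real univ) fun h => by
    change ‖∫ t, f t (e (s t)) * h (s t) ∂μ‖ ≤ _
    refine (norm_integral_le_of_norm_le_const (C := M * ‖h‖) ?_).trans (le_of_eq (by ring))
    filter_upwards [hμA] with t ht
    have h1 : ‖f t (e (s t))‖ ≤ M :=
      hM (t, e (s t)) ⟨ht, mem_closedBall_zero_iff.2 (e.norm_coe_le_norm _)⟩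
    rw [norm_mul]
    exact mul_le_mul h1 (h.norm_coe_le_norm _) (norm_nonneg _) ((norm_nonneg _).trans h1)
  refine ⟨Λ, ?_, fun h => rfl⟩
  rw [hasFDerivAt_iff_isLittleO_nhds_zero, isLittleO_iff]
  intro c hc
  have hpos : 0 < μ.real univ + 1 := by positivity
  have hF := fun e : C(K, ℝ) =>
    integrable_of_continuous_comp hA hμA hs (continuous_primitive hf) e
  -- Radius ‖e‖ + 1 leaves room for e + h with ‖h‖ < 1. The modulus c/(μ(univ) + 1) integrates to at
  -- most c, also when μ = 0.
  have huc := (hA.prod (isCompact_closedBall (0 : ℝ) (‖e‖ + 1))).uniformContinuousOn_of_continuous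
    hf.continuousOn
  obtain ⟨δ, hδ, huc⟩ := Metric.uniformContinuousOn_iff_le.1 huc (c / (μ.real univ + 1))
    (by positivity)
  filter_upwards [Metric.ball_mem_nhds (0 : C(K, ℝ)) (lt_min hδ one_pos)] with h hh
  rw [mem_ball_zero_iff] at hh
  change ‖(∫ t, (∫ x in (0)..((e + h) (s t)), f t x) ∂μ)
    - (∫ t, (∫ x in (0)..(e (s t)), f t x) ∂μ) - ∫ t, f t (e (s t)) * h (s t) ∂μ‖ ≤ c * ‖h‖
  have hFs : Integrable (fun t => (∫ x in (0)..((e + h) (s t)), f t x)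
      - (∫ x in (0)..(e (s t)), f t x)) μ := (hF (e + h)).sub (hF e)
  rw [← integral_sub (hF (e + h)) (hF e), ← integral_sub hFs (hint h)]
  have hb : ‖∫ t, ((∫ x in (0)..((e + h) (s t)), f t x) - (∫ x in (0)..(e (s t)), f t x)
      - f t (e (s t)) * h (s t)) ∂μ‖ ≤ (c / (μ.real univ + 1) * ‖h‖) * μ.real univ := by
    refine norm_integral_le_of_norm_le_const ?_
    filter_upwards [hμA] with t ht
    have h1 : |h (s t)| ≤ ‖h‖ := h.norm_coe_le_norm _
    have h2 : |e (s t)| ≤ ‖e‖ := e.norm_coe_le_norm _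
    have h3 := norm_primitive_sub_le (g := f t) (hf.comp (by fun_prop : Continuous fun y => (t, y)))
      (a := e (s t)) (b := h (s t)) (ε := c / (μ.real univ + 1)) (h1.trans_lt hh) fun y hy => by
        have := huc (t, y) ⟨ht, ?_⟩ (t, e (s t)) ⟨ht, ?_⟩ ?_
        · exact this
        · rw [mem_closedBall_zero_iff, Real.norm_eq_abs]
          have h5 : |y| ≤ |y - e (s t)| + |e (s t)| := by
            simpa using abs_add_le (y - e (s t)) (e (s t))
          linarith [hy.trans_le (min_le_right _ _)]
        · rw [mem_closedBall_zero_iff, Real.norm_eq_abs]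
          linarith
        · rw [Prod.dist_eq, dist_self, max_eq_right dist_nonneg, Real.dist_eq]
          exact (hy.trans_le (min_le_left _ _)).le
    exact h3.trans (by gcongr)
  refine hb.trans ?_
  rw [div_mul_eq_mul_div, div_mul_eq_mul_div, div_le_iff₀ hpos]
  nlinarith [mul_nonneg hc.le (norm_nonneg h)]

/-- A bounded continuous function on `A × ℝ`, `A` closed, extends to the plane. -/
theorem exists_bounded_continuous_extension (hA : IsClosed A)
    (hf : ContinuousOn (Function.uncurry f) (A ×ˢ univ)) {M : ℝ}
    (hfM : ∀ t ∈ A, ∀ x, |f t x| ≤ M) :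
    ∃ g : ℝ → ℝ → ℝ, Continuous (Function.uncurry g) ∧ (∃ M', ∀ t x, |g t x| ≤ M') ∧
      ∀ t ∈ A, g t = f t := by
  let φ : BoundedContinuousFunction (A ×ˢ (univ : Set ℝ) : Set (ℝ × ℝ)) ℝ :=
    BoundedContinuousFunction.ofNormedAddCommGroup
      (fun q => Function.uncurry f q) hf.domRestrict M fun q => hfM _ q.2.1 _
  -- Tietze's theorem on the closed set A × ℝ.
  obtain ⟨g, -, hg⟩ := φ.exists_norm_eq_domRestrict_eq_of_closed (hA.prod isClosed_univ)
  refine ⟨fun t x => g (t, x), g.continuous, ⟨‖g‖, fun t x => g.norm_coe_le_norm _⟩,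
    fun t ht => funext fun x => ?_⟩
  exact DFunLike.congr_fun hg ⟨(t, x), ht, mem_univ _⟩

end Nemytskii

end TimeScale

namespace TimeScale

/-! ### Jump operators and Δ-differentiability -/

section JumpOperator

variable {S : Set ℝ} {s t : ℝ}

theorem bddBelow_inter_Ioi (S : Set ℝ) (t : ℝ) : BddBelow (S ∩ Ioi t) := ⟨t, fun _ hy => hy.2.le⟩

theorem le_fwd (S : Set ℝ) (t : ℝ) : t ≤ fwd S t := by
  unfold fwd
  split_ifs with h
  · exact le_csInf h fun y hy => hy.2.le
  · exact le_rfl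

theorem fwd_le_of_lt (hs : s ∈ S) (hts : t < s) : fwd S t ≤ s := by
  rw [fwd, if_pos ⟨s, hs, hts⟩]
  exact csInf_le (bddBelow_inter_Ioi S t) ⟨hs, hts⟩

theorem fwd_mem (hS : IsClosed S) (ht : t ∈ S) : fwd S t ∈ S := by
  unfold fwd
  split_ifs with h
  · exact closure_minimal inter_subset_left hS (csInf_mem_closure h (bddBelow_inter_Ioi S t))
  · exact ht

theorem fwd_mono (S : Set ℝ) : Monotone (fwd S) := by
  intro a b hab
  rcases (S ∩ Ioi a).eq_empty_or_nonempty with h | ⟨r, hr, har⟩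
  · rw [fwd, if_neg (not_nonempty_iff_eq_empty.2 h)]
    exact hab.trans (le_fwd S b)
  · by_cases h2 : (S ∩ Ioi b).Nonempty
    · rw [fwd, fwd, if_pos ⟨r, hr, har⟩, if_pos h2]
      exact csInf_le_csInf (bddBelow_inter_Ioi S a) h2
        (inter_subset_inter_right _ (Ioi_subset_Ioi hab))
    · have hrb : r ≤ b := not_lt.1 fun hlt => h2 ⟨r, hr, hlt⟩
      exact (fwd_le_of_lt hr har).trans (hrb.trans (le_fwd S b))

theorem exists_mem_lt_of_fwd_eq (hσ : fwd S t = t) {r : ℝ} (hr : r ∈ S) (htr : t < r) {ε : ℝ}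
    (hε : 0 < ε) : ∃ q ∈ S, t < q ∧ q < t + ε := by
  have hne : (S ∩ Ioi t).Nonempty := ⟨r, hr, htr⟩
  rw [fwd, if_pos hne] at hσ
  obtain ⟨q, hq, hqt⟩ := exists_lt_of_csInf_lt hne (show sInf (S ∩ Ioi t) < t + ε by linarith)
  exact ⟨q, hq.1, hq.2, hqt⟩

/-- The forward jump operator is continuous where it has a fixed point. -/
theorem tendsto_fwd (hσ : fwd S t = t) : Tendsto (fwd S) (𝓝[S] t) (𝓝 t) := by
  rw [Metric.tendsto_nhds]
  intro ε hε
  by_cases h : (S ∩ Ioi t).Nonempty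
  · obtain ⟨r, hr, htr⟩ := h
    obtain ⟨q, hq, htq, hqε⟩ := exists_mem_lt_of_fwd_eq hσ hr htr hε
    filter_upwards [mem_nhdsWithin_of_mem_nhds (Ioo_mem_nhds (show t - ε < t by linarith) htq)]
      with s hs
    rw [Real.dist_eq, abs_lt]
    constructor <;> linarith [le_fwd S s, fwd_le_of_lt hq hs.2, hs.1]
  · filter_upwards [mem_nhdsWithin_of_mem_nhds (Ioi_mem_nhds (show t - ε < t by linarith)),
      self_mem_nhdsWithin] with s hs hsS
    have hst : s ≤ t := not_lt.1 fun hlt => h ⟨s, hsS, hlt⟩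
    rw [Real.dist_eq, abs_lt]
    have h1 : fwd S s ≤ t := (fwd_mono S hst).trans hσ.le
    have h2 := le_fwd S s
    have h3 : t - ε < s := hs
    constructor <;> linarith

theorem HasDeltaDerivAt.congr {f g : ℝ → ℝ} {d : ℝ} (hf : HasDeltaDerivAt S f d t)
    (hfg : ∀ s ∈ S, f s = g s) (hσ : fwd S t ∈ S) : HasDeltaDerivAt S g d t := by
  unfold HasDeltaDerivAt at *
  refine hf.congr' ?_ EventuallyEq.rfl
  filter_upwards [self_mem_nhdsWithin] with s hs
  rw [hfg s hs, hfg _ hσ]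

theorem hasDeltaDerivAt_const_mul_id (S : Set ℝ) (c t : ℝ) :
    HasDeltaDerivAt S (fun s => c * s) c t := by
  unfold HasDeltaDerivAt
  refine (isLittleO_zero _ _).congr_left fun s => ?_
  ring

theorem hasDeltaDerivAt_const (S : Set ℝ) (c t : ℝ) : HasDeltaDerivAt S (fun _ => c) 0 t := by
  unfold HasDeltaDerivAt
  refine (isLittleO_zero _ _).congr_left fun s => ?_
  ring

/-- The defining error tends to 0 since σ(t) - s stays bounded, so f(s) tends to f(σ(t)) - d(σ(t) -
t), which is f(t) by `slope_of_scattered`. -/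
theorem HasDeltaDerivAt.continuousWithinAt {f : ℝ → ℝ} {d : ℝ} (hf : HasDeltaDerivAt S f d t)
    (ht : t ∈ S) : ContinuousWithinAt f S t := by
  have h1 : Tendsto (fun s => fwd S t - s) (𝓝[S] t) (𝓝 (fwd S t - t)) :=
    tendsto_nhdsWithin_of_tendsto_nhds ((continuous_const.sub continuous_id).tendsto t)
  have h2 : Tendsto (fun s => f (fwd S t) - f s - d * (fwd S t - s)) (𝓝[S] t) (𝓝 0) :=
    (isLittleO_one_iff ℝ).1 (IsLittleO.trans_isBigO hf (h1.isBigO_one ℝ))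
  have h3 := ((h1.const_mul d).add h2).const_sub (f (fwd S t))
  have h4 := slope_of_scattered ht hf
  rw [ContinuousWithinAt]
  convert h3 using 2
  · ring
  · rw [h4]; ring

/-- The only point that S^κ can omit is a left-scattered maximum, which is isolated in S. -/
theorem continuousOn_of_hasDeltaDerivAt {f f' : ℝ → ℝ}
    (hf : ∀ t ∈ kappa S, HasDeltaDerivAt S f (f' t) t) : ContinuousOn f S := by
  intro t ht
  by_cases hk : t ∈ kappa S
  · exact (hf t hk).continuousWithinAt ht
  · have hk' : IsGreatest S t ∧ bwd S t < t := not_not.1 fun h => hk ⟨ht, h⟩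
    refine (continuousWithinAt_const (b := f t)).congr_of_eventuallyEq ?_ rfl
    filter_upwards [mem_nhdsWithin_of_mem_nhds (Ioi_mem_nhds hk'.2), self_mem_nhdsWithin]
      with s hs hsS
    rcases (hk'.1.2 hsS).eq_or_lt with h | h
    · rw [h]
    · exfalso
      have hs' : bwd S t < s := hs
      rw [bwd, if_pos ⟨s, hsS, h⟩] at hs'
      exact absurd (le_csSup ⟨t, fun y hy => hy.2.le⟩ (show s ∈ S ∩ Iio t from ⟨hsS, h⟩))
        (not_le.2 hs')

theorem RdContinuousOn.of_continuousOn {g : ℝ → ℝ} (hg : ContinuousOn g S) :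
    RdContinuousOn S g :=
  ⟨fun t ht => hg t ht.1, fun t ht => ⟨g t, (hg t ht.1).mono inter_subset_left⟩⟩

end JumpOperator

/-! ### Primitives and integration by parts for the Δ-measure -/

section Measure

variable {𝕋 : Set ℝ} {T : ℝ} {g w : ℝ → ℝ} {s t : ℝ}

theorem isClosed_interval (h : IsClosed 𝕋) : IsClosed (interval 𝕋 T) := h.inter isClosed_Icc

theorem ae_mem_interval (h : IsClosed 𝕋) (h0 : (0 : ℝ) ∈ 𝕋) (hT𝕋 : T ∈ 𝕋) (hT : 0 < T) :
    ∀ᵐ t ∂(deltaMeasure 𝕋 T), t ∈ interval 𝕋 T ∧ t < T := by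
  refine measure_mono_null ?_ (deltaMeasure_compl h h0 hT𝕋 hT)
  exact fun t ht hm => ht ⟨hm.1, hm.2.2⟩

/-- This is where σ enters integration by parts. No point of J lies strictly between s and σ(s).
Comparing total masses, both at most σ(s), treats right-dense s too, where {s} has to be null. -/
theorem Ico_fwd_ae_eq_Iic (h : IsClosed 𝕋) (h0 : (0 : ℝ) ∈ 𝕋) (hT𝕋 : T ∈ 𝕋) (hT : 0 < T)
    (hs : s ∈ interval 𝕋 T) :
    Ico 0 (fwd (interval 𝕋 T) s) =ᵐ[deltaMeasure 𝕋 T] Iic s := by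
  have hσ := fwd_mem (isClosed_interval h) hs
  refine ae_eq_of_ae_subset_of_measure_ge ?_ ?_ measurableSet_Ico.nullMeasurableSet
    (measure_ne_top _ _)
  · filter_upwards [ae_mem_interval h h0 hT𝕋 hT] with t ht h1
    exact not_lt.1 fun hlt => absurd (fwd_le_of_lt ht.1 hlt) (not_le.2 h1.2)
  · rw [deltaMeasure_Ico h h0 hT ⟨h0, le_rfl, hT.le⟩ hσ, deltaMeasure,
      Measure.map_apply_of_aemeasurable (proj_aemeasurable h h0 hT) measurableSet_Iic,
      Measure.restrict_apply' measurableSet_Ico, ← Real.volume_Icc]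
    refine measure_mono fun y hy => ⟨hy.2.1, ?_⟩
    exact (le_fwd_proj h h0 hT𝕋 hT hy.2).trans (fwd_mono _ hy.1)

theorem setIntegral_Ico_sub (hg : Integrable g (deltaMeasure 𝕋 T)) {a b : ℝ} (ha : 0 ≤ a)
    (hab : a ≤ b) :
    (∫ r in Ico 0 b, g r ∂(deltaMeasure 𝕋 T)) - (∫ r in Ico 0 a, g r ∂(deltaMeasure 𝕋 T))
      = ∫ r in Ico a b, g r ∂(deltaMeasure 𝕋 T) := by
  rw [← Ico_union_Ico_eq_Ico ha hab, setIntegral_union (Ico_disjoint_Ico_same)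
    measurableSet_Ico hg.integrableOn hg.integrableOn]
  ring

/-- A mean value inequality that looks at g only on J ∩ [a,b); with ε = 0 it gives the exact
increment across a gap. -/
theorem abs_primitive_sub_le (h : IsClosed 𝕋) (h0 : (0 : ℝ) ∈ 𝕋) (hT𝕋 : T ∈ 𝕋) (hT : 0 < T)
    (hg : Integrable g (deltaMeasure 𝕋 T)) {a b c ε : ℝ} (ha : a ∈ interval 𝕋 T)
    (hb : b ∈ interval 𝕋 T) (hab : a ≤ b)
    (hε : ∀ r ∈ interval 𝕋 T, a ≤ r → r < b → |g r - c| ≤ ε) :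
    |(∫ r in Ico 0 b, g r ∂(deltaMeasure 𝕋 T)) - (∫ r in Ico 0 a, g r ∂(deltaMeasure 𝕋 T))
      - c * (b - a)| ≤ ε * (b - a) := by
  have hm : (deltaMeasure 𝕋 T).real (Ico a b) = b - a := by
    rw [Measure.real, deltaMeasure_Ico h h0 hT ha hb, ENNReal.toReal_ofReal (sub_nonneg.2 hab)]
  have h1 : (∫ r in Ico 0 b, g r ∂(deltaMeasure 𝕋 T)) - (∫ r in Ico 0 a, g r ∂(deltaMeasure 𝕋 T))
      - c * (b - a) = ∫ r in Ico a b, (g r - c) ∂(deltaMeasure 𝕋 T) := by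
    rw [setIntegral_Ico_sub hg ha.2.1 hab, integral_sub hg.integrableOn (integrable_const c),
      setIntegral_const, hm, smul_eq_mul]
    ring
  rw [h1, ← hm, ← Real.norm_eq_abs]
  refine norm_setIntegral_le_of_norm_le_const_ae' (measure_lt_top (deltaMeasure 𝕋 T) _) ?_
  filter_upwards [ae_mem_interval h h0 hT𝕋 hT] with r hr hrab
  exact hε r hr.1 hrab.1 hrab.2

/-- The `Δ`-derivative of a primitive. -/
theorem hasDeltaDerivAt_primitive (h : IsClosed 𝕋) (h0 : (0 : ℝ) ∈ 𝕋) (hT𝕋 : T ∈ 𝕋) (hT : 0 < T)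
    (hg : Integrable g (deltaMeasure 𝕋 T)) {M : ℝ} (hM : ∀ r ∈ interval 𝕋 T, |g r| ≤ M)
    (ht : t ∈ interval 𝕋 T)
    (hc : fwd (interval 𝕋 T) t = t → ContinuousWithinAt g (interval 𝕋 T) t) :
    HasDeltaDerivAt (interval 𝕋 T) (fun t => ∫ r in Ico 0 t, g r ∂(deltaMeasure 𝕋 T)) (g t) t := by
  have hσ := fwd_mem (isClosed_interval h) ht
  have key := fun {a b c ε} => abs_primitive_sub_le h h0 hT𝕋 hT hg (a := a) (b := b) (c := c)
    (ε := ε)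
  unfold HasDeltaDerivAt
  rw [isLittleO_iff]
  intro ε hε
  rcases (le_fwd (interval 𝕋 T) t).eq_or_lt with heq | hlt
  · have hc' := hc heq.symm
    rw [← heq]
    have he : ∀ᶠ s in 𝓝[interval 𝕋 T] t, dist (g s) (g t) < ε := Metric.tendsto_nhds.1 hc' ε hε
    rw [eventually_nhdsWithin_iff, Metric.eventually_nhds_iff] at he
    obtain ⟨δ, hδ, he⟩ := he
    rw [eventually_nhdsWithin_iff]
    filter_upwards [Metric.ball_mem_nhds t hδ] with s hs hsJ
    rw [Metric.mem_ball, Real.dist_eq, abs_lt] at hs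
    rw [Real.norm_eq_abs, Real.norm_eq_abs]
    rcases le_total s t with hst | hst
    · rw [abs_of_nonneg (sub_nonneg.2 hst)]
      refine key hsJ ht hst fun r hr h1 h2 => (he ?_ hr).le
      rw [Real.dist_eq, abs_lt]
      constructor <;> linarith [hs.1, hs.2]
    · rw [abs_of_nonpos (sub_nonpos.2 hst), ← abs_neg]
      have := key ht hsJ hst (c := g t) (ε := ε) fun r hr h1 h2 => (he ?_ hr).le
      · convert this using 2
        · ring
        · ring
      · rw [Real.dist_eq, abs_lt]
        constructor <;> linarith [hs.1, hs.2]
  · have hM0 : 0 ≤ M := (abs_nonneg _).trans (hM t ht)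
    set σ := fwd (interval 𝕋 T) t with hσdef
    -- The only point of J in [t, σ(t)) is t, so the increment over the gap is exactly g(t)(σ(t) -
    -- t).
    have h1 := key ht hσ hlt.le (c := g t) (ε := 0) fun r hr h1 h2 => by
      rcases h1.eq_or_lt with h3 | h3
      · simp [h3]
      · exact absurd (fwd_le_of_lt hr h3) (not_le.2 h2)
    rw [zero_mul] at h1
    have h1' := abs_eq_zero.1 (le_antisymm h1 (abs_nonneg _))
    -- For s ≤ t the error is at most 2M(t - s), while ε(σ(t) - s) stays above ε(σ(t) - t). This δ
    -- makes the former smaller without continuity of g; the +1 avoids division by zero.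
    have hδ : 0 < ε * (σ - t) / (2 * M + 1) := by
      have := sub_pos.2 hlt
      positivity
    rw [eventually_nhdsWithin_iff]
    filter_upwards [Ioo_mem_nhds (sub_lt_self t hδ) hlt] with s hs hsJ
    have hst : s ≤ t := not_lt.1 fun h3 => absurd (fwd_le_of_lt hsJ h3) (not_le.2 hs.2)
    have h2 := key hsJ ht hst (c := g t) (ε := 2 * M) fun r hr _ _ => by
      have e1 := abs_le.1 (hM r hr)
      have e2 := abs_le.1 (hM t ht)
      rw [abs_le]
      constructor <;> linarith [e1.1, e1.2, e2.1, e2.2]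
    have h3 : (t - s) * (2 * M + 1) ≤ ε * (σ - t) := by
      rw [← le_div_iff₀ (by positivity)]
      linarith [hs.1]
    rw [Real.norm_eq_abs, Real.norm_eq_abs, abs_of_nonneg (by linarith : 0 ≤ σ - s)]
    have h4 : ε * (σ - t) ≤ ε * (σ - s) := by gcongr
    calc _ = |(∫ r in Ico 0 t, g r ∂(deltaMeasure 𝕋 T))
        - (∫ r in Ico 0 s, g r ∂(deltaMeasure 𝕋 T)) - g t * (t - s)| := by
          congr 1
          linarith
      _ ≤ 2 * M * (t - s) := h2
      _ ≤ ε * (σ - s) := by linarith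

/-- Integration by parts: the primitive of `w` vanishes at `0` and `T`. -/
theorem integral_primitive_mul (h : IsClosed 𝕋) (h0 : (0 : ℝ) ∈ 𝕋) (hT𝕋 : T ∈ 𝕋) (hT : 0 < T)
    (hg : Integrable g (deltaMeasure 𝕋 T)) (hw : Integrable w (deltaMeasure 𝕋 T))
    (hw0 : ∫ t, w t ∂(deltaMeasure 𝕋 T) = 0) :
    ∫ t, (∫ s in Ico 0 t, g s ∂(deltaMeasure 𝕋 T)) * w t ∂(deltaMeasure 𝕋 T)
      = -∫ s, g s * (∫ t in Ico 0 (fwd (interval 𝕋 T) s), w t ∂(deltaMeasure 𝕋 T))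
          ∂(deltaMeasure 𝕋 T) := by
  set μ := deltaMeasure 𝕋 T with hμ
  have hJ := ae_mem_interval h h0 hT𝕋 hT
  have hset : MeasurableSet {q : ℝ × ℝ | q.2 < q.1} := measurableSet_lt measurable_snd measurable_fst
  -- Fubini on {s < t}: the inner integral of w over t > s is minus that over t ≤ s, as the total is
  -- 0, and the latter is the primitive of w at σ(s).
  have hI : Integrable (Function.uncurry fun t s => (Iio t).indicator g s * w t) (μ.prod μ) := by
    have := (hw.mul_prod hg).indicator hset
    refine this.congr (Eventually.of_forall fun q => ?_)
    by_cases hq : q.2 < q.1 <;> simp [indicator, hq, Function.uncurry, mul_comm]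
  have h1 : ∀ t, (∫ s in Ico 0 t, g s ∂μ) = ∫ s, (Iio t).indicator g s ∂μ := by
    intro t
    rw [integral_indicator measurableSet_Iio]
    refine setIntegral_congr_set ?_
    filter_upwards [hJ] with s hs
    exact propext ⟨fun hm => hm.2, fun hm => ⟨hs.1.2.1, hm⟩⟩
  have h2 : ∀ᵐ s ∂μ, (∫ t, (Iio t).indicator g s * w t ∂μ)
      = -(g s * ∫ t in Ico 0 (fwd (interval 𝕋 T) s), w t ∂μ) := by
    filter_upwards [hJ] with s hs
    rw [setIntegral_congr_set (Ico_fwd_ae_eq_Iic h h0 hT𝕋 hT hs.1)]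
    have h3 : (fun t => (Iio t).indicator g s * w t) = fun t => g s * (Iic s)ᶜ.indicator w t := by
      ext t
      by_cases hq : s < t <;> simp [indicator, hq]
    have h4 := integral_add_compl (measurableSet_Iic (a := s)) hw
    rw [h3, integral_const_mul, integral_indicator measurableSet_Iic.compl]
    rw [hw0] at h4
    rw [eq_neg_of_add_eq_zero_right h4]
    ring
  calc ∫ t, (∫ s in Ico 0 t, g s ∂μ) * w t ∂μ
      = ∫ t, ∫ s, (Iio t).indicator g s * w t ∂μ ∂μ := by
        congr 1
        ext t
        rw [h1, integral_mul_const]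
    _ = ∫ s, ∫ t, (Iio t).indicator g s * w t ∂μ ∂μ := integral_integral_swap hI
    _ = _ := by rw [integral_congr_ae h2, integral_neg]

end Measure

end TimeScale

namespace TimeScale

/-! ### Compact embedding into C(J), the Poincaré inequality and u ↦ u^σ -/

section Embedding

variable {𝕋 : Set ℝ} {T : ℝ}

instance : CompleteSpace (H10 𝕋 T) :=
  (Submodule.isClosed_topologicalClosure (c1ZeroRd 𝕋 T)).completeSpace_coe

/-- The operator `u ↦ u^Δ`. -/
noncomputable def H10.deltaL (𝕋 : Set ℝ) (T : ℝ) : H10 𝕋 T →L[ℝ] Lp ℝ 2 (deltaMeasure 𝕋 T) :=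
  (WithLp.sndL 2 ℝ _ _).comp (H10 𝕋 T).subtypeL

theorem H10.coeFn_deltaL (u : H10 𝕋 T) : ⇑(H10.deltaL 𝕋 T u) = H10.delta u := rfl

theorem H10.inner_deltaL (u v : H10 𝕋 T) :
    inner ℝ (H10.deltaL 𝕋 T u) (H10.deltaL 𝕋 T v)
      = ∫ t, H10.delta u t * H10.delta v t ∂(deltaMeasure 𝕋 T) := by
  rw [L2.inner_def]
  refine integral_congr_ae (Eventually.of_forall fun t => ?_)
  simp [H10.coeFn_deltaL, mul_comm]

theorem H10.norm_deltaL_sq (u : H10 𝕋 T) :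
    ‖H10.deltaL 𝕋 T u‖ ^ 2 = ∫ t, (H10.delta u t) ^ 2 ∂(deltaMeasure 𝕋 T) := by
  rw [← real_inner_self_eq_norm_sq, H10.inner_deltaL]
  simp only [pow_two]

theorem H10.memLp_delta (u : H10 𝕋 T) : MemLp (H10.delta u) 2 (deltaMeasure 𝕋 T) :=
  Lp.memLp (u : L2Pair 𝕋 T).snd

theorem H10.integrable_delta (u : H10 𝕋 T) : Integrable (H10.delta u) (deltaMeasure 𝕋 T) :=
  (H10.memLp_delta u).integrable (by norm_num)

theorem isCompact_interval (h : IsClosed 𝕋) : IsCompact (interval 𝕋 T) :=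
  isCompact_Icc.inter_left h

/-- The indicators of `[0,t)`, `t ∈ J`, as a continuous curve in `L²_Δ`. -/
noncomputable def indicatorCurve (h : IsClosed 𝕋) (h0 : (0 : ℝ) ∈ 𝕋) (hT : 0 < T) :
    C(interval 𝕋 T, Lp ℝ 2 (deltaMeasure 𝕋 T)) where
  toFun t := indicatorConstLp 2 (measurableSet_Ico (a := (0 : ℝ)) (b := (t : ℝ)))
    (measure_ne_top _ _) 1
  continuous_toFun := by
    -- The symmetric difference of [0,x) and [0,y) lies in the interval between x and y, of
    -- Δ-measure |y - x|.
    refine continuous_indicatorConstLp_set (by norm_num) fun x => ?_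
    have hlim : Tendsto (fun y : interval 𝕋 T => ENNReal.ofReal |(y : ℝ) - x|) (𝓝 x) (𝓝 0) := by
      have hc : Continuous fun y : interval 𝕋 T => ENNReal.ofReal |(y : ℝ) - x| :=
        ENNReal.continuous_ofReal.comp (by fun_prop)
      simpa using hc.tendsto x
    refine tendsto_of_tendsto_of_tendsto_of_le_of_le tendsto_const_nhds hlim
      (fun _ => zero_le) fun y => ?_
    dsimp only
    rcases le_total (x : ℝ) y with hxy | hxy
    · rw [abs_of_nonneg (sub_nonneg.2 hxy), ← deltaMeasure_Ico h h0 hT x.2 y.2]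
      refine measure_mono ?_
      rintro z (⟨hz, hz'⟩ | ⟨hz, hz'⟩)
      · exact ⟨not_lt.1 fun hlt => hz' ⟨hz.1, hlt⟩, hz.2⟩
      · exact absurd ⟨hz.1, hz.2.trans_le hxy⟩ hz'
    · rw [abs_of_nonpos (sub_nonpos.2 hxy), neg_sub, ← deltaMeasure_Ico h h0 hT y.2 x.2]
      refine measure_mono ?_
      rintro z (⟨hz, hz'⟩ | ⟨hz, hz'⟩)
      · exact absurd ⟨hz.1, hz.2.trans_le hxy⟩ hz'
      · exact ⟨not_lt.1 fun hlt => hz' ⟨hz.1, hlt⟩, hz.2⟩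

/-- The embedding of `H¹_{0,Δ}(J)` into `C(J)`. -/
noncomputable def H10.valueL (h : IsClosed 𝕋) (h0 : (0 : ℝ) ∈ 𝕋) (hT : 0 < T)
    [CompactSpace (interval 𝕋 T)] : H10 𝕋 T →L[ℝ] C(interval 𝕋 T, ℝ) :=
  (innerKernel (indicatorCurve h h0 hT)).comp (H10.deltaL 𝕋 T)

theorem H10.valueL_apply (h : IsClosed 𝕋) (h0 : (0 : ℝ) ∈ 𝕋) (hT : 0 < T)
    [CompactSpace (interval 𝕋 T)] (u : H10 𝕋 T) (t : interval 𝕋 T) :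
    H10.valueL h h0 hT u t = H10.value u t :=
  L2.inner_indicatorConstLp_one measurableSet_Ico (measure_ne_top _ _) (H10.deltaL 𝕋 T u)

theorem H10.isCompactOperator_valueL (h : IsClosed 𝕋) (h0 : (0 : ℝ) ∈ 𝕋) (hT : 0 < T)
    [CompactSpace (interval 𝕋 T)] : IsCompactOperator (H10.valueL h h0 hT) :=
  (isCompactOperator_innerKernel (indicatorCurve h h0 hT)).comp_clm (H10.deltaL 𝕋 T)

/-- The Poincaré inequality. -/
theorem H10.exists_norm_le (h : IsClosed 𝕋) (h0 : (0 : ℝ) ∈ 𝕋) (hT𝕋 : T ∈ 𝕋) (hT : 0 < T) :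
    ∃ C, ∀ u : H10 𝕋 T, ‖u‖ ≤ C * ‖H10.deltaL 𝕋 T u‖ := by
  have : CompactSpace (interval 𝕋 T) := isCompact_iff_compactSpace.1 (isCompact_interval h)
  set κ := innerKernel (indicatorCurve h h0 hT) with hκ
  -- The factor that turns a sup bound into an L² bound on a finite measure space.
  set c : ℝ := (measureUnivNNReal (deltaMeasure 𝕋 T) : ℝ) ^ (2 : ENNReal).toReal⁻¹ with hc
  refine ⟨c * ‖κ‖ + 1, fun u => ?_⟩
  have h1 : ‖(u : L2Pair 𝕋 T).fst‖ ≤ c * (‖κ‖ * ‖H10.deltaL 𝕋 T u‖) := by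
    refine Lp.norm_le_of_ae_bound (by positivity) ?_
    filter_upwards [(H10.value_isRepresentative h h0 hT𝕋 hT u).2.2.2,
      ae_mem_interval h h0 hT𝕋 hT] with t ht htJ
    rw [ht, ← H10.valueL_apply h h0 hT u ⟨t, htJ.1⟩]
    exact ((H10.valueL h h0 hT u).norm_coe_le_norm _).trans (κ.le_opNorm _)
  have h2 : ‖u‖ ^ 2 = ‖(u : L2Pair 𝕋 T).fst‖ ^ 2 + ‖H10.deltaL 𝕋 T u‖ ^ 2 :=
    WithLp.prod_norm_sq_eq_of_L2 (u : L2Pair 𝕋 T)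
  have h3 := norm_nonneg (u : L2Pair 𝕋 T).fst
  have h4 := norm_nonneg (H10.deltaL 𝕋 T u)
  have h5 : ‖u‖ ≤ ‖(u : L2Pair 𝕋 T).fst‖ + ‖H10.deltaL 𝕋 T u‖ := by
    refine le_of_sq_le_sq ?_ (by positivity)
    nlinarith [mul_nonneg h3 h4]
  linarith

open Classical in
/-- The forward jump operator as a measurable map into `J`. -/
noncomputable def jump (h : IsClosed 𝕋) (h0 : (0 : ℝ) ∈ 𝕋) (hT : 0 < T) (t : ℝ) : interval 𝕋 T :=
  ⟨if t ∈ interval 𝕋 T then fwd (interval 𝕋 T) t else 0, by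
    split_ifs with ht
    · exact fwd_mem (isClosed_interval h) ht
    · exact ⟨h0, le_rfl, hT.le⟩⟩

theorem measurable_jump (h : IsClosed 𝕋) (h0 : (0 : ℝ) ∈ 𝕋) (hT : 0 < T) :
    Measurable (jump h h0 hT) :=
  Measurable.subtype_mk (Measurable.ite (isClosed_interval h).measurableSet
    (fwd_mono _).measurable measurable_const)

theorem coe_jump (h : IsClosed 𝕋) (h0 : (0 : ℝ) ∈ 𝕋) (hT : 0 < T) {t : ℝ}
    (ht : t ∈ interval 𝕋 T) : (jump h h0 hT t : ℝ) = fwd (interval 𝕋 T) t := if_pos ht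

theorem H10.shift_eq_valueL (h : IsClosed 𝕋) (h0 : (0 : ℝ) ∈ 𝕋) (hT : 0 < T)
    [CompactSpace (interval 𝕋 T)] (u : H10 𝕋 T) {t : ℝ} (ht : t ∈ interval 𝕋 T) :
    H10.shift u t = H10.valueL h h0 hT u (jump h h0 hT t) := by
  rw [H10.valueL_apply, coe_jump h h0 hT ht, H10.shift]

/-- The operator `e ↦ e ∘ σ` from `C(J)` into an `L²` space. -/
noncomputable def shiftL (h : IsClosed 𝕋) (h0 : (0 : ℝ) ∈ 𝕋) (hT : 0 < T)
    [CompactSpace (interval 𝕋 T)] :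
    C(interval 𝕋 T, ℝ) →L[ℝ] Lp ℝ 2 ((deltaMeasure 𝕋 T).map (jump h h0 hT)) :=
  ContinuousMap.toLp 2 _ ℝ

theorem inner_shiftL (h : IsClosed 𝕋) (h0 : (0 : ℝ) ∈ 𝕋) (hT𝕋 : T ∈ 𝕋) (hT : 0 < T)
    [CompactSpace (interval 𝕋 T)] (u v : H10 𝕋 T) :
    inner ℝ (shiftL h h0 hT (H10.valueL h h0 hT u)) (shiftL h h0 hT (H10.valueL h h0 hT v))
      = ∫ t, H10.shift u t * H10.shift v t ∂(deltaMeasure 𝕋 T) := by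
  rw [shiftL, ContinuousMap.inner_toLp]
  simp only [conj_trivial, ← ContinuousMap.mul_apply]
  rw [integral_map (measurable_jump h h0 hT).aemeasurable (map_continuous _).aestronglyMeasurable]
  refine integral_congr_ae ?_
  filter_upwards [ae_mem_interval h h0 hT𝕋 hT] with t ht
  rw [H10.shift_eq_valueL h h0 hT u ht.1, H10.shift_eq_valueL h h0 hT v ht.1, ContinuousMap.mul_apply,
    mul_comm]

theorem norm_shiftL_sq (h : IsClosed 𝕋) (h0 : (0 : ℝ) ∈ 𝕋) (hT𝕋 : T ∈ 𝕋) (hT : 0 < T)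
    [CompactSpace (interval 𝕋 T)] (u : H10 𝕋 T) :
    ‖shiftL h h0 hT (H10.valueL h h0 hT u)‖ ^ 2
      = ∫ t, (H10.shift u t) ^ 2 ∂(deltaMeasure 𝕋 T) := by
  rw [← real_inner_self_eq_norm_sq, inner_shiftL h h0 hT𝕋 hT]
  simp only [pow_two]

theorem memLp_of_bounded_on_interval (h : IsClosed 𝕋) (h0 : (0 : ℝ) ∈ 𝕋) (hT𝕋 : T ∈ 𝕋)
    (hT : 0 < T) {g : ℝ → ℝ} (hg : AEStronglyMeasurable g (deltaMeasure 𝕋 T)) {M : ℝ}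
    (hM : ∀ t ∈ interval 𝕋 T, |g t| ≤ M) (p : ENNReal) : MemLp g p (deltaMeasure 𝕋 T) := by
  refine MemLp.of_bound hg M ?_
  filter_upwards [ae_mem_interval h h0 hT𝕋 hT] with t ht using hM t ht.1

theorem exists_bound_on_interval (h : IsClosed 𝕋) {g : ℝ → ℝ}
    (hg : ContinuousOn g (interval 𝕋 T)) : ∃ M, ∀ t ∈ interval 𝕋 T, |g t| ≤ M :=
  (isCompact_interval h).exists_bound_of_continuousOn hg

theorem memLp_of_continuousOn_interval (h : IsClosed 𝕋) (h0 : (0 : ℝ) ∈ 𝕋) (hT𝕋 : T ∈ 𝕋)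
    (hT : 0 < T) {g : ℝ → ℝ} (hg : ContinuousOn g (interval 𝕋 T)) (p : ENNReal) :
    MemLp g p (deltaMeasure 𝕋 T) := by
  obtain ⟨M, hM⟩ := exists_bound_on_interval h hg
  refine memLp_of_bounded_on_interval h h0 hT𝕋 hT ?_ hM p
  have h1 := hg.aestronglyMeasurable (μ := deltaMeasure 𝕋 T) (isClosed_interval h).measurableSet
  rwa [Measure.restrict_eq_self_of_ae_mem
    ((ae_mem_interval h h0 hT𝕋 hT).mono fun t ht => ht.1)] at h1

/-- Supplies the test functions of the du Bois-Reymond argument and turns a classical eigenfunction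
into an element of H. Its values are recovered by `setIntegral_delta`. -/
theorem H10.exists_of_isC1ZeroRd (h : IsClosed 𝕋) (h0 : (0 : ℝ) ∈ 𝕋) (hT𝕋 : T ∈ 𝕋)
    (hT : 0 < T) {φ φ' : ℝ → ℝ} (hφ : IsC1ZeroRd 𝕋 T φ φ')
    (hφ' : MemLp φ' 2 (deltaMeasure 𝕋 T)) :
    ∃ u : H10 𝕋 T, H10.delta u =ᵐ[deltaMeasure 𝕋 T] φ' ∧
      ∀ t ∈ interval 𝕋 T, H10.value u t = φ t := by
  have hφL : MemLp φ 2 (deltaMeasure 𝕋 T) := memLp_of_continuousOn_interval h h0 hT𝕋 hT hφ.1 2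
  let w : L2Pair 𝕋 T := WithLp.toLp 2 (hφL.toLp φ, hφ'.toLp φ')
  have hw : w ∈ c1ZeroRd 𝕋 T := ⟨φ, φ', hφ, hφL.coeFn_toLp, hφ'.coeFn_toLp⟩
  have hd : H10.delta (⟨w, Submodule.le_topologicalClosure _ hw⟩ : H10 𝕋 T)
    =ᵐ[deltaMeasure 𝕋 T] φ' := hφ'.coeFn_toLp
  refine ⟨⟨w, Submodule.le_topologicalClosure _ hw⟩, hd, fun t ht => ?_⟩
  rw [← setIntegral_delta h h0 hT𝕋 hT hφ (hφ'.integrable (by norm_num)) ht]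
  exact integral_congr_ae (ae_restrict_of_ae hd)

end Embedding

end TimeScale

namespace TimeScale

/-! ### Weak and classical Dirichlet eigenfunctions -/

section Regularity

variable {𝕋 : Set ℝ} {T : ℝ}

/-- `J^κ` is again a time scale interval. -/
theorem exists_kappa_eq_interval (h : IsClosed 𝕋) (h0 : (0 : ℝ) ∈ 𝕋) (hT𝕋 : T ∈ 𝕋) (hT : 0 < T) :
    ∃ T' ∈ 𝕋, 0 ≤ T' ∧ T' ≤ T ∧ kappa (interval 𝕋 T) = interval 𝕋 T' ∧
      ∀ s ∈ interval 𝕋 T, s < T → s ≤ T' := by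
  have hTJ : T ∈ interval 𝕋 T := ⟨hT𝕋, hT.le, le_rfl⟩
  have hg : ∀ t, IsGreatest (interval 𝕋 T) t ↔ t = T := fun t =>
    ⟨fun ht => le_antisymm ht.1.2.2 (ht.2 hTJ), by
      rintro rfl; exact ⟨hTJ, fun s hs => hs.2.2⟩⟩
  -- T' is ρ(T) if T is left-scattered and T otherwise; T' = 0 means J = {0,T}.
  by_cases hb : bwd (interval 𝕋 T) T < T
  · have hne : (interval 𝕋 T ∩ Iio T).Nonempty := ⟨0, ⟨h0, le_rfl, hT.le⟩, hT⟩
    have hbd : BddAbove (interval 𝕋 T ∩ Iio T) := ⟨T, fun y hy => hy.2.le⟩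
    have hle : ∀ s ∈ interval 𝕋 T, s < T → s ≤ bwd (interval 𝕋 T) T := fun s hs hsT => by
      rw [bwd, if_pos hne]
      exact le_csSup hbd ⟨hs, hsT⟩
    have hmem : bwd (interval 𝕋 T) T ∈ interval 𝕋 T := by
      rw [bwd, if_pos hne]
      exact closure_minimal inter_subset_left (isClosed_interval h) (csSup_mem_closure hne hbd)
    refine ⟨_, hmem.1, hmem.2.1, hmem.2.2, ?_, hle⟩
    ext t
    constructor
    · rintro ⟨ht, ht'⟩
      rw [hg] at ht'
      have htT : t ≠ T := fun he => ht' ⟨he, he ▸ hb⟩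
      exact ⟨ht.1, ht.2.1, hle t ht (ht.2.2.lt_of_ne htT)⟩
    · rintro ⟨ht, ht1, ht2⟩
      refine ⟨⟨ht, ht1, ht2.trans hmem.2.2⟩, fun hc => ?_⟩
      rw [(hg t).1 hc.1] at ht2
      exact absurd hb (not_lt.2 ht2)
  · refine ⟨T, hT𝕋, hT.le, le_rfl, ?_, fun s _ hs => hs.le⟩
    ext t
    refine ⟨fun ht => ht.1, fun ht => ⟨ht, fun hc => hb ?_⟩⟩
    rw [hg] at hc
    exact hc.1 ▸ hc.2

theorem proj_congr {T' : ℝ} (hT' : T' ≤ T) {x : ℝ} (hx : x ≤ T') : proj 𝕋 T' x = proj 𝕋 T x := by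
  unfold proj
  congr 1
  ext z
  exact ⟨fun hz => ⟨⟨hz.1.1, hz.1.2.1, hz.1.2.2.trans hT'⟩, hz.2⟩,
    fun hz => ⟨⟨hz.1.1, hz.1.2.1, le_trans hz.2 hx⟩, hz.2⟩⟩

/-- The restriction t < T' matters: at T' itself the jump operator of the smaller interval stays
put, while that of J may jump to T. -/
theorem fwd_interval_congr {T' : ℝ} (hT' : T' ≤ T) (hT'𝕋 : T' ∈ 𝕋) {t : ℝ} (ht0 : 0 ≤ t)
    (ht : t < T') : fwd (interval 𝕋 T') t = fwd (interval 𝕋 T) t := by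
  have hm : T' ∈ interval 𝕋 T' := ⟨hT'𝕋, ht0.trans ht.le, le_rfl⟩
  have hsub : interval 𝕋 T' ⊆ interval 𝕋 T := fun z hz => ⟨hz.1, hz.2.1, hz.2.2.trans hT'⟩
  have hne : (interval 𝕋 T ∩ Ioi t).Nonempty := ⟨T', hsub hm, ht⟩
  have hne' : (interval 𝕋 T' ∩ Ioi t).Nonempty := ⟨T', hm, ht⟩
  rw [fwd, fwd, if_pos hne, if_pos hne']
  refine le_antisymm (le_csInf hne fun z hz => ?_) (csInf_le_csInf (bddBelow_inter_Ioi _ t) hne'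
    (inter_subset_inter_left _ hsub))
  rcases le_total z T' with hz' | hz'
  · exact csInf_le (bddBelow_inter_Ioi _ t) ⟨⟨hz.1.1, hz.1.2.1, hz'⟩, hz.2⟩
  · exact (csInf_le (bddBelow_inter_Ioi _ t) ⟨hm, ht⟩).trans hz'

variable {u : ℝ → ℝ}

theorem memLp_comp_fwd (h : IsClosed 𝕋) (h0 : (0 : ℝ) ∈ 𝕋) (hT𝕋 : T ∈ 𝕋) (hT : 0 < T)
    (hu : ContinuousOn u (interval 𝕋 T)) (p : ENNReal) :
    MemLp (fun t => u (fwd (interval 𝕋 T) t)) p (deltaMeasure 𝕋 T) := by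
  obtain ⟨M, hM⟩ := exists_bound_on_interval h hu
  refine memLp_of_bounded_on_interval h h0 hT𝕋 hT ?_
    (fun t ht => hM _ (fwd_mem (isClosed_interval h) ht)) p
  have h1 : Measurable fun t => (interval 𝕋 T).domRestrict u (jump h h0 hT t) :=
    hu.domRestrict.measurable.comp (measurable_jump h h0 hT)
  refine h1.aestronglyMeasurable.congr ?_
  filter_upwards [ae_mem_interval h h0 hT𝕋 hT] with t ht
  rw [Set.domRestrict_apply, coe_jump h h0 hT ht.1]

/-- Continuity of u ∘ σ is needed only where σ(t) = t, and there σ is continuous by `tendsto_fwd`.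
-/
theorem hasDeltaDerivAt_primitive_comp_fwd (h : IsClosed 𝕋) (h0 : (0 : ℝ) ∈ 𝕋) (hT𝕋 : T ∈ 𝕋)
    (hT : 0 < T) (hu : ContinuousOn u (interval 𝕋 T)) {t : ℝ} (ht : t ∈ interval 𝕋 T) :
    HasDeltaDerivAt (interval 𝕋 T)
      (fun t => ∫ r in Ico 0 t, u (fwd (interval 𝕋 T) r) ∂(deltaMeasure 𝕋 T))
      (u (fwd (interval 𝕋 T) t)) t := by
  obtain ⟨M, hM⟩ := exists_bound_on_interval h hu
  refine hasDeltaDerivAt_primitive h h0 hT𝕋 hT (g := fun t => u (fwd (interval 𝕋 T) t))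
    ((memLp_comp_fwd h h0 hT𝕋 hT hu 1).integrable le_rfl)
    (fun t ht => hM _ (fwd_mem (isClosed_interval h) ht)) ht fun hσ => ?_
  have h1 : Tendsto (fwd (interval 𝕋 T)) (𝓝[interval 𝕋 T] t) (𝓝[interval 𝕋 T] t) :=
    tendsto_nhdsWithin_iff.2 ⟨tendsto_fwd hσ, eventually_nhdsWithin_of_forall fun s hs =>
      fwd_mem (isClosed_interval h) hs⟩
  rw [ContinuousWithinAt, hσ]
  exact (hu t ht).tendsto.comp h1

/-- The primitive of `u ∘ σ` on `J^κ` does not depend on whether `σ` and the measure are those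
of `J` or of `J^κ`. -/
theorem primitive_comp_fwd_congr (h : IsClosed 𝕋) (h0 : (0 : ℝ) ∈ 𝕋) (hT𝕋 : T ∈ 𝕋) (hT : 0 < T)
    (hu : ContinuousOn u (interval 𝕋 T)) {T' : ℝ} (hT' : T' ≤ T) (hT'𝕋 : T' ∈ 𝕋) (hT'0 : 0 < T')
    {t : ℝ} (ht : t ∈ interval 𝕋 T') :
    ∫ r in Ico 0 t, u (fwd (interval 𝕋 T') r) ∂(deltaMeasure 𝕋 T')
      = ∫ r in Ico 0 t, u (fwd (interval 𝕋 T) r) ∂(deltaMeasure 𝕋 T) := by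
  have hsub : interval 𝕋 T' ⊆ interval 𝕋 T := fun z hz => ⟨hz.1, hz.2.1, hz.2.2.trans hT'⟩
  rw [setIntegral_deltaMeasure h h0 hT'0 (memLp_comp_fwd h h0 hT'𝕋 hT'0 (hu.mono hsub) 1).1 ht,
    setIntegral_deltaMeasure h h0 hT (memLp_comp_fwd h h0 hT𝕋 hT hu 1).1 (hsub ht)]
  -- Dropping the right end point leaves only x < T', where both projections and both jump operators
  -- agree.
  rw [intervalIntegral.integral_of_le ht.2.1, intervalIntegral.integral_of_le ht.2.1,
    integral_Ioc_eq_integral_Ioo, integral_Ioc_eq_integral_Ioo]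
  refine setIntegral_congr_fun measurableSet_Ioo fun x hx => ?_
  have hxT' : x < T' := hx.2.trans_le ht.2.2
  have h1 := proj_spec h h0 hT hx.1.le
  rw [proj_congr hT' hxT'.le, fwd_interval_congr hT' hT'𝕋 h1.1.2.1 (h1.2.1.trans_lt hxT')]

/-- A function orthogonal to all `Δ`-derivatives of elements of `H¹_{0,Δ}(J)` is constant. -/
theorem ae_eq_const_of_forall_integral_delta (h : IsClosed 𝕋) (h0 : (0 : ℝ) ∈ 𝕋) (hT𝕋 : T ∈ 𝕋)
    (hT : 0 < T) {w : ℝ → ℝ} (hw : Integrable w (deltaMeasure 𝕋 T))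
    (hw0 : ∀ v : H10 𝕋 T, ∫ t, w t * H10.delta v t ∂(deltaMeasure 𝕋 T) = 0) :
    ∃ c, ∀ᵐ t ∂(deltaMeasure 𝕋 T), w t = c := by
  set μ := deltaMeasure 𝕋 T with hμ
  have hTJ : T ∈ interval 𝕋 T := ⟨hT𝕋, hT.le, le_rfl⟩
  have huniv : Ico 0 T =ᵐ[μ] univ := by
    filter_upwards [ae_mem_interval h h0 hT𝕋 hT] with t ht
    exact propext ⟨fun _ => trivial, fun _ => ⟨ht.1.2.1, ht.2⟩⟩
  have hmass : μ.real univ = T := by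
    rw [← measureReal_congr huniv, Measure.real,
      deltaMeasure_Ico h h0 hT ⟨h0, le_rfl, hT.le⟩ hTJ, sub_zero, ENNReal.toReal_ofReal hT.le]
  set c := T⁻¹ * ∫ t, w t ∂μ with hc
  refine ⟨c, ?_⟩
  have hloc : LocallyIntegrable (fun t => w t - c) μ :=
    (hw.sub (integrable_const c)).locallyIntegrable
  have hzero := ae_eq_zero_of_integral_contDiff_smul_eq_zero hloc fun g hg _ => ?_
  · filter_upwards [hzero] with t ht using sub_eq_zero.1 ht
  have hgc : Continuous g := hg.continuous
  have hgL : MemLp g 2 μ := memLp_of_continuousOn_interval h h0 hT𝕋 hT hgc.continuousOn 2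
  have hgi : Integrable g μ := hgL.integrable (by norm_num)
  -- Subtracting the mean makes the primitive of g - m vanish at T, so g - m is an admissible u^Δ.
  -- Orthogonality of w to it says that w - c is orthogonal to g.
  set m := T⁻¹ * ∫ t, g t ∂μ with hm
  have hψc : Continuous fun t => g t - m := hgc.sub continuous_const
  obtain ⟨M, hM⟩ := exists_bound_on_interval (T := T) h hψc.continuousOn
  have hψL : MemLp (fun t => g t - m) 2 μ :=
    memLp_of_continuousOn_interval h h0 hT𝕋 hT hψc.continuousOn 2
  have hψi : Integrable (fun t => g t - m) μ := hψL.integrable (by norm_num)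
  have hder : ∀ t ∈ interval 𝕋 T, HasDeltaDerivAt (interval 𝕋 T)
      (fun t => ∫ r in Ico 0 t, (g r - m) ∂μ) (g t - m) t := fun t ht =>
    hasDeltaDerivAt_primitive h h0 hT𝕋 hT (g := fun t => g t - m) hψi hM ht
      fun _ => hψc.continuousWithinAt
  have hφ : IsC1ZeroRd 𝕋 T (fun t => ∫ r in Ico 0 t, (g r - m) ∂μ) (fun t => g t - m) := by
    refine ⟨fun t ht => (hder t ht).continuousWithinAt ht, fun t ht => hder t ht.1,
      RdContinuousOn.of_continuousOn hψc.continuousOn, by simp, ?_⟩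
    dsimp only
    rw [setIntegral_congr_set huniv, setIntegral_univ, integral_sub hgi (integrable_const m),
      integral_const, hmass, hm, smul_eq_mul, mul_inv_cancel_left₀ hT.ne', sub_self]
  obtain ⟨v, hv, -⟩ := H10.exists_of_isC1ZeroRd h h0 hT𝕋 hT hφ hψL
  have h1 : ∫ t, w t * (g t - m) ∂μ = 0 := by
    rw [← hw0 v]
    refine integral_congr_ae ?_
    filter_upwards [hv] with t ht
    rw [ht]
  obtain ⟨B, hB⟩ := exists_bound_on_interval (T := T) h hgc.continuousOn
  have hwg : Integrable (fun t => w t * g t) μ := by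
    refine hw.mul_bdd (c := B) hgL.1 ?_
    filter_upwards [ae_mem_interval h h0 hT𝕋 hT] with t ht using hB t ht.1
  have h2 : ∫ t, w t * (g t - m) ∂μ = (∫ t, w t * g t ∂μ) - (∫ t, w t ∂μ) * m := by
    simp only [mul_sub]
    rw [integral_sub hwg (hw.mul_const m), integral_mul_const]
  have h3 : ∫ t, g t • (w t - c) ∂μ = (∫ t, w t * g t ∂μ) - c * ∫ t, g t ∂μ := by
    rw [← integral_const_mul, ← integral_sub hwg (hgi.const_mul c)]
    refine integral_congr_ae (Eventually.of_forall fun t => ?_)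
    simp only [smul_eq_mul]
    ring
  rw [h3, sub_eq_zero.1 (h2.symm.trans h1), hc, hm]
  ring

theorem H10.memLp_shift (h : IsClosed 𝕋) (h0 : (0 : ℝ) ∈ 𝕋) (hT𝕋 : T ∈ 𝕋) (hT : 0 < T)
    (u : H10 𝕋 T) (p : ENNReal) : MemLp (H10.shift u) p (deltaMeasure 𝕋 T) :=
  memLp_comp_fwd h h0 hT𝕋 hT (H10.value_isRepresentative h h0 hT𝕋 hT u).1 p

theorem H10.integral_delta (h : IsClosed 𝕋) (h0 : (0 : ℝ) ∈ 𝕋) (hT𝕋 : T ∈ 𝕋) (hT : 0 < T)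
    (u : H10 𝕋 T) : ∫ t, H10.delta u t ∂(deltaMeasure 𝕋 T) = 0 := by
  rw [← (H10.value_isRepresentative h h0 hT𝕋 hT u).2.2.1, H10.value, ← setIntegral_univ]
  refine setIntegral_congr_set ?_
  filter_upwards [ae_mem_interval h h0 hT𝕋 hT] with t ht
  exact propext ⟨fun _ => ⟨ht.1.2.1, ht.2⟩, fun _ => trivial⟩

/-- `∫ w v^Δ = -∫ w^Δ v^σ` for a primitive `w` and `v ∈ H¹_{0,Δ}(J)`. -/
theorem H10.integral_primitive_mul_delta (h : IsClosed 𝕋) (h0 : (0 : ℝ) ∈ 𝕋) (hT𝕋 : T ∈ 𝕋)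
    (hT : 0 < T) {g : ℝ → ℝ} (hg : Integrable g (deltaMeasure 𝕋 T)) (v : H10 𝕋 T) :
    ∫ t, (∫ s in Ico 0 t, g s ∂(deltaMeasure 𝕋 T)) * H10.delta v t ∂(deltaMeasure 𝕋 T)
      = -∫ s, g s * H10.shift v s ∂(deltaMeasure 𝕋 T) :=
  integral_primitive_mul h h0 hT𝕋 hT hg (H10.integrable_delta v)
    (H10.integral_delta h h0 hT𝕋 hT v)

/-- Disposes of J = {0,T}, where J^κ is a single point and `deltaMeasure` on it is not available
with a positive length. -/
theorem eq_zero_of_interval_trivial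
    (hgap : ∀ s ∈ interval 𝕋 T, s < T → s ≤ 0) {u : ℝ → ℝ} (hu0 : u 0 = 0) (huT : u T = 0) {t : ℝ}
    (ht : t ∈ interval 𝕋 T) : u t = 0 := by
  rcases ht.2.2.eq_or_lt with h1 | h1
  · rw [h1, huT]
  · rw [le_antisymm (hgap t ht h1) ht.2.1, hu0]

/-- Weak eigenfunctions are classical eigenfunctions. -/
theorem isDirichletEigenvalue_of_weak (h : IsClosed 𝕋) (h0 : (0 : ℝ) ∈ 𝕋) (hT𝕋 : T ∈ 𝕋)
    (hT : 0 < T) {m : ℝ} (u : H10 𝕋 T) (hne : ∃ t ∈ interval 𝕋 T, H10.value u t ≠ 0)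
    (hweak : ∀ v : H10 𝕋 T, ∫ t, H10.delta u t * H10.delta v t ∂(deltaMeasure 𝕋 T)
      = m * ∫ t, H10.shift u t * H10.shift v t ∂(deltaMeasure 𝕋 T)) :
    IsDirichletEigenvalue 𝕋 T m := by
  obtain ⟨huc, hu0, huT, -⟩ := H10.value_isRepresentative h h0 hT𝕋 hT u
  have hsh : Integrable (H10.shift u) (deltaMeasure 𝕋 T) :=
    (H10.memLp_shift h h0 hT𝕋 hT u 1).integrable le_rfl
  set W : ℝ → ℝ := fun t => ∫ r in Ico 0 t, H10.shift u r ∂(deltaMeasure 𝕋 T) with hW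
  have hWd : ∀ t ∈ interval 𝕋 T, HasDeltaDerivAt (interval 𝕋 T) W (H10.shift u t) t := fun t ht =>
    hasDeltaDerivAt_primitive_comp_fwd h h0 hT𝕋 hT huc ht
  have hWc : ContinuousOn W (interval 𝕋 T) := fun t ht => (hWd t ht).continuousWithinAt ht
  have hWL : MemLp W 2 (deltaMeasure 𝕋 T) := memLp_of_continuousOn_interval h h0 hT𝕋 hT hWc 2
  have hwL : MemLp (fun t => H10.delta u t + m * W t) 2 (deltaMeasure 𝕋 T) :=
    (H10.memLp_delta u).add (hWL.const_mul m)
  obtain ⟨c, hcae⟩ := ae_eq_const_of_forall_integral_delta h h0 hT𝕋 hT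
    (hwL.integrable (by norm_num)) fun v => by
      have h1 : Integrable (fun t => H10.delta u t * H10.delta v t) (deltaMeasure 𝕋 T) :=
        (H10.memLp_delta u).integrable_mul (H10.memLp_delta v)
      have h2 : Integrable (fun t => W t * H10.delta v t) (deltaMeasure 𝕋 T) :=
        hWL.integrable_mul (H10.memLp_delta v)
      have h3 := H10.integral_primitive_mul_delta h h0 hT𝕋 hT hsh v
      have h4 : ∫ t, (H10.delta u t + m * W t) * H10.delta v t ∂(deltaMeasure 𝕋 T)
          = (∫ t, H10.delta u t * H10.delta v t ∂(deltaMeasure 𝕋 T))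
            + m * ∫ t, W t * H10.delta v t ∂(deltaMeasure 𝕋 T) := by
        rw [← integral_const_mul, ← integral_add h1 (h2.const_mul m)]
        refine integral_congr_ae (Eventually.of_forall fun t => ?_)
        ring
      rw [h4, hweak v, hW, h3]
      ring
  -- Integration by parts turns the weak equation into orthogonality of u^Δ + mW to every v^Δ. Hence
  -- u^Δ = c - mW almost everywhere, and this continuous version serves as the classical derivative.
  set u' : ℝ → ℝ := fun t => c - m * W t with hu'
  have hu'c : ContinuousOn u' (interval 𝕋 T) := continuousOn_const.sub (continuousOn_const.mul hWc)
  have hu'i : Integrable u' (deltaMeasure 𝕋 T) :=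
    (memLp_of_continuousOn_interval h h0 hT𝕋 hT hu'c 1).integrable le_rfl
  have hval : ∀ t, (∫ r in Ico 0 t, u' r ∂(deltaMeasure 𝕋 T)) = H10.value u t := fun t => by
    refine integral_congr_ae (ae_restrict_of_ae ?_)
    filter_upwards [hcae] with r hr
    rw [hu', ← hr]
    ring
  obtain ⟨M, hM⟩ := exists_bound_on_interval h hu'c
  refine ⟨H10.value u, u', hne, hu0, huT, fun t ht => ?_, ?_⟩
  · have := hasDeltaDerivAt_primitive h h0 hT𝕋 hT hu'i hM ht.1 fun _ => hu'c t ht.1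
    simpa only [hval] using this
  · obtain ⟨T', hT'𝕋, hT'0, hT'T, hk, hgap⟩ := exists_kappa_eq_interval h h0 hT𝕋 hT
    have hsub : interval 𝕋 T' ⊆ interval 𝕋 T := fun z hz => ⟨hz.1, hz.2.1, hz.2.2.trans hT'T⟩
    rcases hT'0.eq_or_lt with he | hT'0
    · obtain ⟨t, ht, hut⟩ := hne
      exact absurd (eq_zero_of_interval_trivial (he ▸ hgap) hu0 huT ht) hut
    · rw [hk]
      intro t ht
      -- The second derivative is taken on J^κ, so W is rewritten with the measure and the jump
      -- operator of J^κ before differentiating.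
      have h1 := hasDeltaDerivAt_primitive_comp_fwd h h0 hT'𝕋 hT'0 (huc.mono hsub) ht.1
      have h2 := (hasDeltaDerivAt_const (interval 𝕋 T') c t).add (h1.const_smul (-m))
      have h3 : (0 : ℝ) + -m • H10.value u (fwd (interval 𝕋 T') t)
          = -(m * H10.value u (fwd (interval 𝕋 T') t)) := by
        simp
      rw [h3] at h2
      refine h2.congr (fun s hs => ?_) (fwd_mem (isClosed_interval h) ht.1)
      simp only [Pi.add_apply, Pi.smul_apply, smul_eq_mul, hu', hW]
      rw [primitive_comp_fwd_congr h h0 hT𝕋 hT huc hT'T hT'𝕋 hT'0 hs]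
      simp only [H10.shift]
      ring

/-- A Rayleigh quotient bound is a lower bound for the Dirichlet eigenvalues. -/
theorem le_of_isDirichletEigenvalue (h : IsClosed 𝕋) (h0 : (0 : ℝ) ∈ 𝕋) (hT𝕋 : T ∈ 𝕋)
    (hT : 0 < T) {m μ : ℝ}
    (hm : ∀ u : H10 𝕋 T, m * ∫ t, (H10.shift u t) ^ 2 ∂(deltaMeasure 𝕋 T)
      ≤ ∫ t, (H10.delta u t) ^ 2 ∂(deltaMeasure 𝕋 T))
    (hμ : IsDirichletEigenvalue 𝕋 T μ) : m ≤ μ := by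
  obtain ⟨u, u', ⟨t₀, ht₀, hut₀⟩, hu0, huT, hu, hu'⟩ := hμ
  obtain ⟨T', hT'𝕋, hT'0, hT'T, hk, hgap⟩ := exists_kappa_eq_interval h h0 hT𝕋 hT
  have hsub : interval 𝕋 T' ⊆ interval 𝕋 T := fun z hz => ⟨hz.1, hz.2.1, hz.2.2.trans hT'T⟩
  rcases hT'0.eq_or_lt with he | hT'0
  · exact absurd (eq_zero_of_interval_trivial (he ▸ hgap) hu0 huT ht₀) hut₀
  have huc := continuousOn_of_hasDeltaDerivAt hu
  rw [hk] at hu hu'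
  have hu'c := continuousOn_of_hasDeltaDerivAt hu'
  have hC1 : IsC1ZeroRd 𝕋 T u u' :=
    ⟨huc, hk ▸ hu, hk ▸ RdContinuousOn.of_continuousOn hu'c, hu0, huT⟩
  have haeT' : ∀ᵐ t ∂(deltaMeasure 𝕋 T), t ∈ interval 𝕋 T' := by
    filter_upwards [ae_mem_interval h h0 hT𝕋 hT] with t ht
    exact ⟨ht.1.1, ht.1.2.1, hgap t ht.1 ht.2⟩
  set W : ℝ → ℝ := fun t => ∫ r in Ico 0 t, u (fwd (interval 𝕋 T) r) ∂(deltaMeasure 𝕋 T) with hW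
  have hui : Integrable (fun t => u (fwd (interval 𝕋 T) t)) (deltaMeasure 𝕋 T) :=
    (memLp_comp_fwd h h0 hT𝕋 hT huc 1).integrable le_rfl
  have hrep : ∀ t ∈ interval 𝕋 T', u' t = u' 0 - μ * W t := by
    set D : ℝ → ℝ := fun t => u' t
      + μ * ∫ r in Ico 0 t, u (fwd (interval 𝕋 T') r) ∂(deltaMeasure 𝕋 T') with hD
    have hDd : ∀ t ∈ kappa (interval 𝕋 T'), HasDeltaDerivAt (interval 𝕋 T') D 0 t := fun t ht => by
      have h1 := hasDeltaDerivAt_primitive_comp_fwd h h0 hT'𝕋 hT'0 (huc.mono hsub) ht.1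
      have h2 := (hu' t ht).add (h1.const_smul μ)
      rwa [smul_eq_mul, neg_add_cancel] at h2
    have hD0 : D 0 = u' 0 := by simp [hD]
    -- D has zero Δ-derivative and has to be constant. `setIntegral_delta` requires zero boundary
    -- values, so an affine function is subtracted: E vanishes at 0 and T' and has derivative -c.
    -- Thus E(t) = -ct, that is, D(t) = D(0).
    set c := (D T' - D 0) / T' with hc
    set E : ℝ → ℝ := fun t => D t + (-c * t + -D 0) with hE
    have hEd : ∀ t ∈ kappa (interval 𝕋 T'), HasDeltaDerivAt (interval 𝕋 T') E (-c) t :=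
      fun t ht => by
        have := (hDd t ht).add ((hasDeltaDerivAt_const_mul_id (interval 𝕋 T') (-c) t).add
          (hasDeltaDerivAt_const (interval 𝕋 T') (-D 0) t))
        rwa [zero_add, add_zero] at this
    have hEC : IsC1ZeroRd 𝕋 T' E (fun _ => -c) := by
      refine ⟨continuousOn_of_hasDeltaDerivAt (f' := fun _ => -c) hEd, hEd,
        RdContinuousOn.of_continuousOn continuousOn_const, by simp [hE], ?_⟩
      simp only [hE, hc]
      field_simp
      ring
    intro t ht
    have h1 := setIntegral_delta h h0 hT'𝕋 hT'0 hEC (integrable_const _) ht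
    rw [setIntegral_const, Measure.real,
      deltaMeasure_Ico h h0 hT'0 ⟨h0, le_rfl, hT'0.le⟩ ht, sub_zero,
      ENNReal.toReal_ofReal ht.2.1, smul_eq_mul] at h1
    have h2 : D t = u' 0 := by
      rw [← hD0]
      simp only [hE] at h1
      linarith
    simp only [hD] at h2
    rw [primitive_comp_fwd_congr h h0 hT𝕋 hT huc hT'T hT'𝕋 hT'0 ht] at h2
    simp only [hW]
    linarith
  have hWc : ContinuousOn W (interval 𝕋 T) := fun t ht =>
    (hasDeltaDerivAt_primitive_comp_fwd h h0 hT𝕋 hT huc ht).continuousWithinAt ht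
  have hWL : MemLp W 2 (deltaMeasure 𝕋 T) := memLp_of_continuousOn_interval h h0 hT𝕋 hT hWc 2
  have hu'L : MemLp u' 2 (deltaMeasure 𝕋 T) := by
    refine (memLp_of_continuousOn_interval h h0 hT𝕋 hT (g := fun t => u' 0 - μ * W t)
      (continuousOn_const.sub (continuousOn_const.mul hWc)) 2).ae_eq ?_
    filter_upwards [haeT'] with t ht using (hrep t ht).symm
  obtain ⟨v, hvd, hvv⟩ := H10.exists_of_isC1ZeroRd h h0 hT𝕋 hT hC1 hu'L
  have hvs : ∀ᵐ t ∂(deltaMeasure 𝕋 T), u (fwd (interval 𝕋 T) t) = H10.shift v t := by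
    filter_upwards [ae_mem_interval h h0 hT𝕋 hT] with t ht
    exact (hvv _ (fwd_mem (isClosed_interval h) ht.1)).symm
  have hvi := H10.integrable_delta v
  -- The eigenvalue equation tested with v itself: the constant u'(0) drops out because ∫ v^Δ = 0,
  -- and the W term is integrated by parts.
  have henergy : ∫ t, (H10.delta v t) ^ 2 ∂(deltaMeasure 𝕋 T)
      = μ * ∫ t, (H10.shift v t) ^ 2 ∂(deltaMeasure 𝕋 T) := by
    have h1 := H10.integral_primitive_mul_delta h h0 hT𝕋 hT hui v
    have h2 : ∫ t, (H10.delta v t) ^ 2 ∂(deltaMeasure 𝕋 T)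
        = ∫ t, (u' 0 * H10.delta v t - μ * (W t * H10.delta v t)) ∂(deltaMeasure 𝕋 T) := by
      refine integral_congr_ae ?_
      filter_upwards [hvd, haeT'] with t ht ht'
      rw [pow_two]
      nth_rewrite 1 [ht]
      rw [hrep t ht']
      ring
    have h3 : ∫ t, u (fwd (interval 𝕋 T) t) * H10.shift v t ∂(deltaMeasure 𝕋 T)
        = ∫ t, (H10.shift v t) ^ 2 ∂(deltaMeasure 𝕋 T) := by
      refine integral_congr_ae ?_
      filter_upwards [hvs] with t ht
      rw [ht, pow_two]
    have h4 : Integrable (fun t => W t * H10.delta v t) (deltaMeasure 𝕋 T) :=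
      hWL.integrable_mul (H10.memLp_delta v)
    rw [h2, integral_sub (hvi.const_mul _) (h4.const_mul _), integral_const_mul,
      integral_const_mul, H10.integral_delta h h0 hT𝕋 hT v, hW, h1, h3]
    ring
  -- If ∫(v^σ)² were 0, the energy identity would give v^Δ = 0 almost everywhere, hence v = 0.
  have hpos : 0 < ∫ t, (H10.shift v t) ^ 2 ∂(deltaMeasure 𝕋 T) := by
    refine lt_of_le_of_ne (integral_nonneg fun t => sq_nonneg _) fun hz => hut₀ ?_
    rw [← hz, mul_zero, integral_eq_zero_iff_of_nonneg (fun t => sq_nonneg _)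
      (H10.memLp_delta v).integrable_sq] at henergy
    rw [← hvv t₀ ht₀, H10.value]
    refine integral_eq_zero_of_ae (ae_restrict_of_ae ?_)
    filter_upwards [henergy] with t ht using pow_eq_zero_iff (two_ne_zero) |>.1 ht
  have := hm v
  rw [henergy] at this
  exact le_of_mul_le_mul_right this hpos

end Regularity

end TimeScale

namespace TimeScale

/-! ### Coercivity, minimization and the weak equation -/

section Energy

variable {𝕋 : Set ℝ} {T : ℝ}

/-- The quadratic part of the energy is positive definite when `-λ` lies below the first Dirichlet
eigenvalue. -/
theorem exists_quadratic_lower_bound (h : IsClosed 𝕋) (h0 : (0 : ℝ) ∈ 𝕋) (hT𝕋 : T ∈ 𝕋)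
    (hT : 0 < T) {lam : ℝ}
    (hlam : ∀ lam₁ : ℝ, IsLeast {μ : ℝ | 0 < μ ∧ IsDirichletEigenvalue 𝕋 T μ} lam₁ → -lam₁ < lam) :
    ∃ a > 0, ∀ u : H10 𝕋 T, a * ∫ t, (H10.delta u t) ^ 2 ∂(deltaMeasure 𝕋 T)
      ≤ (1 / 2) * (∫ t, (H10.delta u t) ^ 2 ∂(deltaMeasure 𝕋 T))
        + (lam / 2) * (∫ t, (H10.shift u t) ^ 2 ∂(deltaMeasure 𝕋 T)) := by
  have : CompactSpace (interval 𝕋 T) := isCompact_iff_compactSpace.1 (isCompact_interval h)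
  have hS := norm_shiftL_sq h h0 hT𝕋 hT
  by_cases hne : ∃ w, shiftL h h0 hT (H10.valueL h h0 hT w) ≠ 0
  · obtain ⟨C, hC⟩ := H10.exists_norm_le h h0 hT𝕋 hT
    obtain ⟨k, hk, u, hu0, hle, hweak⟩ := exists_rayleigh_maximizer (H10.deltaL 𝕋 T)
      (H10.valueL h h0 hT) (shiftL h h0 hT) hC (H10.isCompactOperator_valueL h h0 hT) hne
    have hle' : ∀ w : H10 𝕋 T, ∫ t, (H10.shift w t) ^ 2 ∂(deltaMeasure 𝕋 T)
        ≤ k * ∫ t, (H10.delta w t) ^ 2 ∂(deltaMeasure 𝕋 T) := fun w => by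
      rw [← hS, ← H10.norm_deltaL_sq]
      exact hle w
    -- Identifies λ₁ with k⁻¹, which brings the hypothesis on λ into play.
    have hleast : IsLeast {μ : ℝ | 0 < μ ∧ IsDirichletEigenvalue 𝕋 T μ} k⁻¹ := by
      refine ⟨⟨inv_pos.2 hk, isDirichletEigenvalue_of_weak h h0 hT𝕋 hT u ?_ fun v => ?_⟩,
        fun μ hμ => le_of_isDirichletEigenvalue h h0 hT𝕋 hT (fun w => ?_) hμ.2⟩
      · by_contra! hz
        refine hu0 ?_
        have : H10.valueL h h0 hT u = 0 := by
          ext t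
          rw [H10.valueL_apply, hz t t.2]
          rfl
        rw [this, map_zero]
      · have := hweak v
        rw [H10.inner_deltaL, inner_shiftL h h0 hT𝕋 hT] at this
        rw [← this, inv_mul_cancel_left₀ hk.ne']
      · rw [inv_mul_le_iff₀ hk]
        exact hle' w
    have hlk := hlam _ hleast
    have hpos : 0 < 1 + lam * k := by
      have := mul_lt_mul_of_pos_right hlk hk
      rw [neg_mul, inv_mul_cancel₀ hk.ne'] at this
      linarith
    -- For λ ≥ 0 the λ-term is nonnegative and 1/2 works; for λ ≤ 0 the Rayleigh bound gives (1 +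
    -- λk)/2.
    refine ⟨min (1 / 2) ((1 + lam * k) / 2), lt_min (by norm_num) (by linarith), fun u => ?_⟩
    have hd : 0 ≤ ∫ t, (H10.delta u t) ^ 2 ∂(deltaMeasure 𝕋 T) :=
      integral_nonneg fun t => sq_nonneg _
    have hs : 0 ≤ ∫ t, (H10.shift u t) ^ 2 ∂(deltaMeasure 𝕋 T) :=
      integral_nonneg fun t => sq_nonneg _
    rcases le_total 0 lam with h1 | h1
    · have h2 := mul_le_mul_of_nonneg_right (min_le_left (1 / 2) ((1 + lam * k) / 2)) hd
      nlinarith [mul_nonneg h1 hs]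
    · have h2 := mul_le_mul_of_nonneg_right (min_le_right (1 / 2) ((1 + lam * k) / 2)) hd
      have h3 := mul_le_mul_of_nonpos_left (hle' u) h1
      linarith
  -- Here ∫(u^σ)² = 0 for every u, so λ plays no role.
  · push Not at hne
    refine ⟨1 / 2, by norm_num, fun u => ?_⟩
    rw [← hS u, hne u]
    simp

/-- The Δ-measure does not see points outside J, so f may be replaced there by an extension. -/
theorem energy_congr (h : IsClosed 𝕋) (h0 : (0 : ℝ) ∈ 𝕋) (hT𝕋 : T ∈ 𝕋) (hT : 0 < T) {lam : ℝ}
    {p : ℕ} {f g : ℝ → ℝ → ℝ} (hfg : ∀ t ∈ interval 𝕋 T, g t = f t) (τ : Fin p → ℝ)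
    (I : Fin p → ℝ → ℝ) : energy 𝕋 T lam f τ I = energy 𝕋 T lam g τ I := by
  ext u
  unfold energy
  congr 1
  refine integral_congr_ae ?_
  filter_upwards [ae_mem_interval h h0 hT𝕋 hT] with t ht
  rw [hfg t ht.1]

theorem abs_intervalIntegral_le {g : ℝ → ℝ} {M : ℝ} (hM : ∀ x, |g x| ≤ M) (a : ℝ) :
    |∫ x in (0)..a, g x| ≤ M * |a| := by
  have := intervalIntegral.norm_integral_le_of_norm_le_const (a := 0) (b := a) (f := g)
    fun x _ => hM x
  simpa using this

/-- The main result for a nonlinearity that is continuous and bounded on the whole plane. -/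
theorem energy_coercive_and_exists_weakSolution (h : IsClosed 𝕋) (h0 : (0 : ℝ) ∈ 𝕋) (hT𝕋 : T ∈ 𝕋) (hT : 0 < T)
    {lam : ℝ}
    (hlam : ∀ lam₁ : ℝ, IsLeast {μ : ℝ | 0 < μ ∧ IsDirichletEigenvalue 𝕋 T μ} lam₁ → -lam₁ < lam)
    {p : ℕ} {τ : Fin p → ℝ} (hτ : ∀ j, τ j ∈ interval 𝕋 T) {f : ℝ → ℝ → ℝ}
    (hf : Continuous (Function.uncurry f)) {I : Fin p → ℝ → ℝ} (hI : ∀ j, Continuous (I j))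
    (hfb : ∃ M : ℝ, ∀ t x, |f t x| ≤ M) (hIb : ∀ j, ∃ M : ℝ, ∀ x : ℝ, |I j x| ≤ M) :
    Tendsto (energy 𝕋 T lam f τ I) (Bornology.cobounded (H10 𝕋 T)) atTop ∧
    ∃ u : H10 𝕋 T, (∀ v : H10 𝕋 T, energy 𝕋 T lam f τ I u ≤ energy 𝕋 T lam f τ I v) ∧
      HasFDerivAt (energy 𝕋 T lam f τ I) (0 : H10 𝕋 T →L[ℝ] ℝ) u ∧
      IsWeakSolution 𝕋 T lam f τ I u := by
  have : CompactSpace (interval 𝕋 T) := isCompact_iff_compactSpace.1 (isCompact_interval h)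
  set D := H10.deltaL 𝕋 T with hD
  set ι := H10.valueL h h0 hT with hι
  set μ := deltaMeasure 𝕋 T with hμ
  set s := jump h h0 hT with hs
  have hsm : Measurable s := measurable_jump h h0 hT
  have hJc : IsCompact (interval 𝕋 T) := isCompact_interval h
  have hJT := ae_mem_interval h h0 hT𝕋 hT
  have hJ : ∀ᵐ t ∂μ, t ∈ interval 𝕋 T := hJT.mono fun t ht => ht.1
  have hshift : ∀ u : H10 𝕋 T, ∀ᵐ t ∂μ, H10.shift u t = ι u (s t) := fun u =>
    hJ.mono fun t ht => H10.shift_eq_valueL h h0 hT u ht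
  have hshL : ∀ u : H10 𝕋 T, MemLp (H10.shift u) 2 μ := fun u => H10.memLp_shift h h0 hT𝕋 hT u 2
  have hshI : ∀ u : H10 𝕋 T, Integrable (fun t => (H10.shift u t) ^ 2) μ := fun u =>
    (hshL u).integrable_sq
  have hfI : ∀ u : H10 𝕋 T, Integrable (fun t => ∫ x in (0)..(H10.shift u t), f t x) μ := fun u => by
    refine (integrable_of_continuous_comp hJc hJ hsm (continuous_primitive hf) (ι u)).congr ?_
    filter_upwards [hshift u] with t ht
    rw [ht]
  obtain ⟨C, hC⟩ := H10.exists_norm_le h h0 hT𝕋 hT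
  set b := ‖innerKernel (indicatorCurve h h0 hT)‖ with hb
  have hιle : ∀ u x, |ι u x| ≤ b * ‖D u‖ := fun u x =>
    ((ι u).norm_coe_le_norm x).trans ((innerKernel (indicatorCurve h h0 hT)).le_opNorm _)
  have hcoer : Tendsto (energy 𝕋 T lam f τ I) (Bornology.cobounded (H10 𝕋 T)) atTop := by
    obtain ⟨a, ha, hquad⟩ := exists_quadratic_lower_bound h h0 hT𝕋 hT hlam
    obtain ⟨M, hM⟩ := hfb
    choose N hN using hIb
    have hM0 : 0 ≤ M := (abs_nonneg _).trans (hM 0 0)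
    -- Primitives of bounded functions grow at most linearly, and |u(t)| ≤ b‖D u‖ on J.
    refine tendsto_atTop_of_quadratic_le D hC ha
      (b := (∑ j, N j * b) + M * b * μ.real univ) fun u => ?_
    have h1 : |∑ j, (∫ x in (0)..(H10.value u (τ j)), I j x)| ≤ (∑ j, N j * b) * ‖D u‖ := by
      rw [Finset.sum_mul]
      refine (Finset.abs_sum_le_sum_abs _ _).trans (Finset.sum_le_sum fun j _ => ?_)
      refine (abs_intervalIntegral_le (hN j) _).trans ?_
      have hN0 : 0 ≤ N j := (abs_nonneg _).trans (hN j 0)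
      have h2 := hιle u ⟨τ j, hτ j⟩
      rw [hι, H10.valueL_apply] at h2
      rw [mul_assoc]
      exact mul_le_mul_of_nonneg_left h2 hN0
    have h2 : |∫ t, (∫ x in (0)..(H10.shift u t), f t x) ∂μ| ≤ M * (b * ‖D u‖) * μ.real univ := by
      rw [← Real.norm_eq_abs]
      refine norm_integral_le_of_norm_le_const ?_
      filter_upwards [hshift u] with t ht
      rw [ht]
      exact (abs_intervalIntegral_le (hM t) _).trans
        (mul_le_mul_of_nonneg_left (hιle u _) hM0)
    have h3 := hquad u
    rw [← H10.norm_deltaL_sq] at h3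
    have h4 := (abs_le.1 h1).1
    have h5 := (abs_le.1 h2).2
    unfold energy
    rw [← H10.norm_deltaL_sq]
    linarith
  refine ⟨hcoer, ?_⟩
  -- Absorbing λx into the nonlinearity puts the λ-term into Ψ, so everything except ½‖D u‖² factors
  -- through the compact `ι`.
  set f₁ : ℝ → ℝ → ℝ := fun t x => f t x - lam * x with hf₁
  have hf₁c : Continuous (Function.uncurry f₁) := by
    have : Continuous fun q : ℝ × ℝ => lam * q.2 := by fun_prop
    exact hf.sub this
  set Ψ : C(interval 𝕋 T, ℝ) → ℝ := fun e => (∑ j, ∫ x in (0)..(e ⟨τ j, hτ j⟩), I j x)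
    - ∫ t, (∫ x in (0)..(e (s t)), f₁ t x) ∂μ with hΨ
  have hener : energy 𝕋 T lam f τ I = fun u => (1 / 2) * ‖D u‖ ^ 2 + Ψ (ι u) := by
    ext u
    have h1 : ∫ t, (∫ x in (0)..(ι u (s t)), f₁ t x) ∂μ
        = (∫ t, (∫ x in (0)..(H10.shift u t), f t x) ∂μ)
          - (lam / 2) * ∫ t, (H10.shift u t) ^ 2 ∂μ := by
      rw [← integral_const_mul, ← integral_sub (hfI u) ((hshI u).const_mul _)]
      refine integral_congr_ae ?_
      filter_upwards [hshift u] with t ht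
      rw [← ht, hf₁, intervalIntegral.integral_sub, intervalIntegral.integral_const_mul,
        integral_id]
      · ring
      · exact (hf.comp (by fun_prop : Continuous fun y => (t, y))).intervalIntegrable _ _
      · exact (by fun_prop : Continuous fun x => lam * x).intervalIntegrable _ _
    simp only [hΨ, energy]
    rw [h1, ← H10.norm_deltaL_sq]
    simp only [hι, H10.valueL_apply]
    ring
  have hΨd : ∀ e, ∃ Λ : C(interval 𝕋 T, ℝ) →L[ℝ] ℝ, HasFDerivAt Ψ Λ e ∧
      ∀ k, Λ k = (∑ j, I j (e ⟨τ j, hτ j⟩) * k ⟨τ j, hτ j⟩)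
        - ∫ t, f₁ t (e (s t)) * k (s t) ∂μ := by
    intro e
    obtain ⟨Λ, hΛ, hΛ'⟩ := exists_hasFDerivAt_integral_primitive hJc hJ hsm hf₁c e
    have hj : ∀ j, HasFDerivAt (fun e : C(interval 𝕋 T, ℝ) => ∫ x in (0)..(e ⟨τ j, hτ j⟩), I j x)
        (I j (e ⟨τ j, hτ j⟩) • ContinuousMap.evalCLM ℝ (⟨τ j, hτ j⟩ : interval 𝕋 T)) e := by
      intro j
      have h1 := intervalIntegral.integral_hasDerivAt_right ((hI j).intervalIntegrable 0
        (e ⟨τ j, hτ j⟩)) ((hI j).stronglyMeasurableAtFilter _ _) (hI j).continuousAt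
      exact h1.comp_hasFDerivAt e
        (ContinuousMap.evalCLM ℝ (⟨τ j, hτ j⟩ : interval 𝕋 T)).hasFDerivAt
    refine ⟨_, (HasFDerivAt.fun_sum fun j _ => hj j).sub hΛ, fun k => ?_⟩
    simp [hΛ']
  have hΨc : Continuous Ψ := continuous_iff_continuousAt.2 fun e => by
    obtain ⟨Λ, hΛ, -⟩ := hΨd e
    exact hΛ.continuousAt
  obtain ⟨u, hu⟩ := exists_minimizer_of_compact D ι hC (H10.isCompactOperator_valueL h h0 hT) hΨc
    (hener ▸ hcoer)
  obtain ⟨Λ, hΛ, hΛ'⟩ := hΨd (ι u)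
  have hder := ((D.hasFDerivAt (x := u)).norm_sq.const_mul (1 / 2 : ℝ)).add
    (hΛ.comp u ι.hasFDerivAt)
  have hmin : ∀ v, energy 𝕋 T lam f τ I u ≤ energy 𝕋 T lam f τ I v := fun v => by
    rw [hener]
    exact hu v
  -- The derivative of the decomposed energy at its minimizer is 0; evaluated at v it is the weak
  -- equation.
  have hzero := (show IsLocalMin _ u from Eventually.of_forall hu).hasFDerivAt_eq_zero hder
  refine ⟨u, hmin, ?_, fun v => ?_⟩
  · rw [hener, ← hzero]
    exact hder
  · have h1 := DFunLike.congr_fun hzero v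
    simp only [add_apply, ContinuousLinearMap.comp_apply, hΛ', smul_apply, zero_apply,
      smul_eq_mul, nsmul_eq_mul, Nat.cast_ofNat, innerSL_apply_apply, hD, H10.inner_deltaL] at h1
    have hfi : Integrable (fun t => f t (H10.shift u t) * H10.shift v t) μ := by
      have h2 := (integrable_of_continuous_comp hJc hJ hsm hf (ι u)).mul_bdd
        (c := ‖ι v‖) ((ι v).continuous.measurable.comp hsm).aestronglyMeasurable
        (Eventually.of_forall fun t => (ι v).norm_coe_le_norm _)
      refine h2.congr ?_
      filter_upwards [hshift u, hshift v] with t ht ht'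
      rw [ht, ht']
      rfl
    have hsi : Integrable (fun t => H10.shift u t * H10.shift v t) μ :=
      (hshL u).integrable_mul (hshL v)
    have h2 : ∫ t, f₁ t (ι u (s t)) * ι v (s t) ∂μ
        = (∫ t, f t (H10.shift u t) * H10.shift v t ∂μ)
          - lam * ∫ t, H10.shift u t * H10.shift v t ∂μ := by
      rw [← integral_const_mul, ← integral_sub hfi (hsi.const_mul _)]
      refine integral_congr_ae ?_
      filter_upwards [hshift u, hshift v] with t ht ht'
      rw [← ht, ← ht', hf₁]
      ring
    rw [h2] at h1
    simp only [hι, H10.valueL_apply] at h1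
    linarith

end Energy

end TimeScale

theorem mainTheorem3 (𝕋 : Set ℝ) (h𝕋 : IsClosed 𝕋) (T : ℝ) (hT : 0 < T)
    (h0𝕋 : (0 : ℝ) ∈ 𝕋) (hT𝕋 : T ∈ 𝕋)
    (lam : ℝ)
    (hlam : ∀ lam₁ : ℝ, IsLeast {μ : ℝ | 0 < μ ∧ TimeScale.IsDirichletEigenvalue 𝕋 T μ} lam₁ →
      -lam₁ < lam)
    (p : ℕ) (τ : Fin p → ℝ) (hτmono : StrictMono τ)
    (hτ : ∀ j, τ j ∈ Set.Ioo 0 T ∧ TimeScale.IsRightDense 𝕋 (τ j))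
    (f : ℝ → ℝ → ℝ)
    (hf : ContinuousOn (Function.uncurry f) (TimeScale.interval 𝕋 T ×ˢ Set.univ))
    (I : Fin p → ℝ → ℝ) (hI : ∀ j, Continuous (I j))
    (hfb : ∃ M : ℝ, ∀ t ∈ TimeScale.interval 𝕋 T, ∀ x : ℝ, |f t x| ≤ M)
    (hIb : ∀ j, ∃ M : ℝ, ∀ x : ℝ, |I j x| ≤ M) :
    Filter.Tendsto (TimeScale.energy 𝕋 T lam f τ I)
      (Bornology.cobounded (TimeScale.H10 𝕋 T)) Filter.atTop ∧
    ∃ u : TimeScale.H10 𝕋 T,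
      (∀ v : TimeScale.H10 𝕋 T,
        TimeScale.energy 𝕋 T lam f τ I u ≤ TimeScale.energy 𝕋 T lam f τ I v) ∧
      HasFDerivAt (TimeScale.energy 𝕋 T lam f τ I) (0 : TimeScale.H10 𝕋 T →L[ℝ] ℝ) u ∧
      TimeScale.IsWeakSolution 𝕋 T lam f τ I u := by
  obtain ⟨M, hM⟩ := hfb
  -- f is controlled only on J × ℝ. A bounded continuous extension to the plane changes neither the
  -- energy nor the weak equation.
  obtain ⟨g, hgc, hgb, hgf⟩ :=
    TimeScale.exists_bounded_continuous_extension (TimeScale.isClosed_interval h𝕋) hf hM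
  have hτJ : ∀ j, τ j ∈ TimeScale.interval 𝕋 T := fun j =>
    ⟨(hτ j).2.1, (hτ j).1.1.le, (hτ j).1.2.le⟩
  rw [TimeScale.energy_congr h𝕋 h0𝕋 hT𝕋 hT hgf]
  obtain ⟨hco, u, hmin, hder, hweak⟩ :=
    TimeScale.energy_coercive_and_exists_weakSolution h𝕋 h0𝕋 hT𝕋 hT hlam hτJ hgc hI hgb hIb
  refine ⟨hco, u, hmin, hder, fun v => ?_⟩
  rw [hweak v]
  congr 1
  refine integral_congr_ae ?_
  filter_upwards [TimeScale.ae_mem_interval h𝕋 h0𝕋 hT𝕋 hT] with t ht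
  rw [hgf t ht.1]
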